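/- Let $\mathbb{H}$ be the 3-dimensional discrete Heisenberg group, i.e. the group of matrices $\begin{pmatrix}1&a&c\\0&1&b\\0&0&1\end{pmatrix}$ with $a,b,c\in\mathbb{Z}$. For a finite generating set $S$ of $\mathbb{H}$, let $\mathrm{Cay}(\mathbb{H},S)$ be the simple graph with vertex set $\mathbb{H}$ in which distinct $g,h$ are adjacent iff $g^{-1}h\in S\cup S^{-1}$. Identify it with its topological realization, in which every edge is a unit interval, equipped with the path metric and with the measure $\mu(A)=\sum_e\lambda(A\cap e)$, where the sum is over the edges $e\cong[0,1]$ and $\lambda$ is Lebesgue measure. A $1$-thick embedding of a finite simple graph $G$ into a metric space $Y$ is a continuous map $f$ from the topological realization of $G$ to $Y$ such that $d_Y(f(a),f(b))\ge 1$ whenever $a$ and $b$ are two distinct vertices, a vertex and a (closed) edge that does not contain it, or two (closed) edges without a common vertex; here $d_Y$ between sets is the infimum of the distances of their points. The diameter of $f$ is the diameter of its image. If $Y$ carries a measure, the volume of $f$ is the measure of the closed $1$-neighbourhood of its image. **Theorem B.** Let $d\in\mathbb{N}$ and let $S\subseteq\mathbb{H}$ be a finite generating set. There exists a constant $C$ (depending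 only on $d$ and $S$) such that for every finite simple graph $G$ with $n$ vertices and maximum degree $\le d$, there is a $1$-thick embedding of $G$ into $\mathrm{Cay}(\mathbb{H},S)$ with diameter $\le C n^{1/3}\log(1+n)$ and volume $\le C n^{4/3}\log^2(1+n)$. -/

import Mathlib

open MeasureTheory Set
open scoped ENNReal NNReal unitInterval

/-! ### The discrete Heisenberg group -/

/-- The 3-dimensional discrete Heisenberg group: the element `⟨a, b, c⟩` stands for the
integer upper triangular matrix with rows `(1, a, c)`, `(0, 1, b)`, `(0, 0, 1)`. -/
@[ext]
structure Heisenberg where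
  a : ℤ
  b : ℤ
  c : ℤ

namespace Heisenberg

/-- The matrix represented by an element of the Heisenberg group. -/
def toMatrix (g : Heisenberg) : Matrix (Fin 3) (Fin 3) ℤ :=
  !![1, g.a, g.c; 0, 1, g.b; 0, 0, 1]

instance : Mul Heisenberg :=
  ⟨fun g h => ⟨g.a + h.a, g.b + h.b, g.c + h.c + g.a * h.b⟩⟩

instance : One Heisenberg := ⟨⟨0, 0, 0⟩⟩

instance : Inv Heisenberg := ⟨fun g => ⟨-g.a, -g.b, g.a * g.b - g.c⟩⟩

@[simp] theorem mul_a (g h : Heisenberg) : (g * h).a = g.a + h.a := rfl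
@[simp] theorem mul_b (g h : Heisenberg) : (g * h).b = g.b + h.b := rfl
@[simp] theorem mul_c (g h : Heisenberg) : (g * h).c = g.c + h.c + g.a * h.b := rfl
@[simp] theorem one_a : (1 : Heisenberg).a = 0 := rfl
@[simp] theorem one_b : (1 : Heisenberg).b = 0 := rfl
@[simp] theorem one_c : (1 : Heisenberg).c = 0 := rfl
@[simp] theorem inv_a (g : Heisenberg) : g⁻¹.a = -g.a := rfl
@[simp] theorem inv_b (g : Heisenberg) : g⁻¹.b = -g.b := rfl
@[simp] theorem inv_c (g : Heisenberg) : g⁻¹.c = g.a * g.b - g.c := rfl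

instance : Group Heisenberg :=
  Group.ofLeftAxioms
    (fun g h k => by ext <;> simp <;> ring)
    (fun g => by ext <;> simp)
    (fun g => by ext <;> simp)

/-- The group law is multiplication of matrices. -/
theorem toMatrix_mul (g h : Heisenberg) : (g * h).toMatrix = g.toMatrix * h.toMatrix := by
  ext i j
  fin_cases i <;> fin_cases j <;>
    simp [toMatrix, Matrix.mul_apply, Fin.sum_univ_three] <;> ring

end Heisenberg

/-! ### Topological realization of a graph -/

section Realization

variable {V : Type*} (G : SimpleGraph V)

/-- The gluing relation for the topological realization. Start with the vertices and a unit
interval for every oriented edge; the ends of an interval are glued to the end vertices of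
the edge, and the intervals of the two orientations of an edge are glued by `t ↦ 1 - t`. -/
inductive Glue : V ⊕ (G.Dart × I) → V ⊕ (G.Dart × I) → Prop
  | source (d : G.Dart) : Glue (Sum.inr (d, 0)) (Sum.inl d.fst)
  | target (d : G.Dart) : Glue (Sum.inr (d, 1)) (Sum.inl d.snd)
  | symm (d : G.Dart) (t : I) : Glue (Sum.inr (d, t)) (Sum.inr (d.symm, unitInterval.symm t))

/-- The topological realization of a graph, as a set. -/
def Realization : Type _ := Quot (Glue G)

variable {G}

/-- A vertex as a point of the realization. -/
def Realization.vertex (v : V) : Realization G := Quot.mk _ (Sum.inl v)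

/-- The point at parameter `t` on the edge `d`, run through from `d.fst` to `d.snd`. -/
def Realization.edge (d : G.Dart) (t : I) : Realization G := Quot.mk _ (Sum.inr (d, t))

/-- The quotient topology: a set is open iff its preimage in the interval of every edge is. -/
instance : TopologicalSpace (Realization G) :=
  ⨆ d : G.Dart, TopologicalSpace.coinduced (Realization.edge d) inferInstance

end Realization

/-! ### A graph as a metric measure space -/

section MetricGraph

variable {V : Type*} (G : SimpleGraph V)

/-- The same set of points, considered with the path metric and the length measure. -/
def MetricGraph : Type _ := Realization G

variable {G}

namespace MetricGraph

/-- The point at parameter `t` on the edge `d`, run through from `d.fst` to `d.snd`. -/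
def edge (d : G.Dart) (t : I) : MetricGraph G := Realization.edge d t

/-- `HasPath x y ℓ`: there is a path of length `ℓ` from `x` to `y` that consists of finitely
many segments, each of them inside one (closed) edge, edges having length `1`. -/
inductive HasPath : MetricGraph G → MetricGraph G → ℝ≥0 → Prop
  | nil (x : MetricGraph G) : HasPath x x 0
  | cons (d : G.Dart) (s t : I) (y : MetricGraph G) (l : ℝ≥0) :
      HasPath (edge d t) y l → HasPath (edge d s) y (nndist s t + l)

theorem HasPath.trans {x y z : MetricGraph G} {l m : ℝ≥0} (h : HasPath x y l)
    (h' : HasPath y z m) : HasPath x z (l + m) := by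
  induction h with
  | nil x => simpa using h'
  | cons d s t y l _ ih =>
    rw [add_assoc]
    exact .cons d s t z _ (ih h')

theorem HasPath.symm {x y : MetricGraph G} {l : ℝ≥0} (h : HasPath x y l) : HasPath y x l := by
  induction h with
  | nil x => exact .nil x
  | cons d s t y l _ ih =>
    have h1 : HasPath (edge d t) (edge d s) (nndist t s + 0) := .cons d t s _ 0 (.nil _)
    have h2 := ih.trans h1
    rwa [add_zero, nndist_comm, add_comm] at h2

/-- The path metric: the distance is the infimum of the lengths of the paths (and `∞` if
there is none). -/
noncomputable instance : PseudoEMetricSpace (MetricGraph G) where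
  edist x y := ⨅ (l : ℝ≥0) (_ : HasPath x y l), (l : ℝ≥0∞)
  edist_self x := le_antisymm (iInf₂_le_of_le 0 (.nil x) (by simp)) (by simp)
  edist_comm x y := by
    have key : ∀ x y : MetricGraph G, (⨅ (l : ℝ≥0) (_ : HasPath x y l), (l : ℝ≥0∞)) ≤
        ⨅ (l : ℝ≥0) (_ : HasPath y x l), (l : ℝ≥0∞) := fun x y =>
      le_iInf₂ fun l h => iInf₂_le l h.symm
    exact le_antisymm (key x y) (key y x)
  edist_triangle x y z := by
    simp only [ENNReal.iInf_add, ENNReal.add_iInf]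
    refine le_iInf₂ fun m h' => le_iInf₂ fun l h => ?_
    exact iInf₂_le_of_le (l + m) (h.trans h') (by push_cast; exact le_rfl)

/-- A set is measurable iff its intersection with every edge is Lebesgue measurable. -/
instance : MeasurableSpace (MetricGraph G) where
  MeasurableSet' A := ∀ d : G.Dart, NullMeasurableSet (edge d ⁻¹' A) (volume : Measure I)
  measurableSet_empty _ := .empty
  measurableSet_compl _ h d := (h d).compl
  measurableSet_iUnion A h d := by
    rw [preimage_iUnion]
    exact .iUnion fun n => h n d

/-- One of the two orientations of an edge. -/
noncomputable def dartOfEdge (e : G.edgeSet) : G.Dart :=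
  ⟨(Quot.out e.1 : V × V), by
    have h : s((Quot.out e.1 : V × V).1, (Quot.out e.1 : V × V).2) = e.1 := Quot.out_eq e.1
    rw [← SimpleGraph.mem_edgeSet, h]
    exact e.2⟩

/-- The length measure of the graph: the sum over the edges of Lebesgue measure on the edge.
(Lebesgue measure is here the completed one, defined on all Lebesgue measurable sets; the
choice of the orientations does not matter, as `t ↦ 1 - t` preserves it.) -/
noncomputable def lengthMeasure : Measure (MetricGraph G) :=
  Measure.sum fun e : G.edgeSet =>
    Measure.map
      (fun t : NullMeasurableSpace I (volume : Measure I) => edge (dartOfEdge e) t)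
      (volume : Measure I).completion

/-- `μ A` is the sum over the edges `e` of the Lebesgue measure of `A ∩ e`. -/
theorem lengthMeasure_apply {A : Set (MetricGraph G)} (hA : MeasurableSet A) :
    lengthMeasure A = ∑' e : G.edgeSet, volume (edge (dartOfEdge e) ⁻¹' A) := by
  rw [lengthMeasure, Measure.sum_apply _ hA]
  refine tsum_congr fun e => ?_
  have hm : Measurable
      (fun t : NullMeasurableSpace I (volume : Measure I) => edge (dartOfEdge e) t) :=
    fun B (hB : ∀ d : G.Dart, NullMeasurableSet (edge d ⁻¹' B) (volume : Measure I)) =>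
      hB (dartOfEdge e)
  rw [Measure.map_apply hm hA, Measure.coe_completion]
  rfl

end MetricGraph

end MetricGraph

/-! ### Thick embeddings -/

section Thick

variable {V : Type*} {G : SimpleGraph V} {Y : Type*} [PseudoEMetricSpace Y]

/-- A `T`-thick embedding of the graph `G` into the metric space `Y`: a continuous map of the
topological realization such that the images of two distinct vertices, of a vertex and a
(closed) edge not containing it, and of two (closed) edges without a common vertex are at
distance at least `T`. -/
structure IsThickEmbedding (T : ℝ≥0∞) (f : Realization G → Y) : Prop where
  continuous : Continuous f
  vertex_vertex : ∀ u v : V, u ≠ v → T ≤ edist (f (.vertex u)) (f (.vertex v))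
  vertex_edge : ∀ (v : V) (d : G.Dart), v ∉ d.edge →
    ∀ t : I, T ≤ edist (f (.vertex v)) (f (.edge d t))
  edge_edge : ∀ d d' : G.Dart, (∀ v : V, v ∈ d.edge → v ∉ d'.edge) →
    ∀ s t : I, T ≤ edist (f (.edge d s)) (f (.edge d' t))

/-- The volume of a map into a metric measure space: the measure of the closed
`1`-neighbourhood of the image. -/
noncomputable def thickVolume [MeasurableSpace Y] (μ : Measure Y) (f : Realization G → Y) :
    ℝ≥0∞ :=
  μ (Metric.cthickening 1 (range f))

end Thick

/-! ### Paths inside a set of vertices -/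

namespace SimpleGraph

variable {V : Type*} {G : SimpleGraph V}

/-! In the plane of pairs `(b, c)`, a point is the projection of a line of the first generator, and
a line `c = o + t * b` of integer slope is the projection of a line of the second generator lying in
the layer `a = t`. A path in the group that alternates between the generators is therefore a chain
of incidences between points and lines of this plane.

The vertices of the graph become distinct points of an `N × N²` grid, with `N` of order `n^(1/3)`.
For each edge, both ends are routed to a common meeting point along boundedly many lines. The
meeting point and an auxiliary slope are picked among `N^4` options, and a count
(`sum_card_filter_mem_route_le`) shows that for a random pick every line has expected load `O(d)`.
An exponential moment argument (`exists_choice_two_pow_load_le`) gives one choice for which all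
loads are `O(log n)`. Greedy colouring (`exists_coloring_of_degree_le`) then gives `O(log n)`
colours such that edges of equal colour share no line.

Stretching the picture by a factor `R` proportional to the number of colours leaves room to run
different colours at different heights. Ladders at the vertex positions join these heights. Each
edge receives a connected set of `O(N log n)` vertices (`linkedIn_routeNetwork`), and edges without
a common end receive disjoint sets (`disjoint_network`).

This takes place in the standard Cayley graph. For a general generating set, a large dilation
followed by thickening keeps the sets connected and disjoint (`linkedIn_thicken`,
`exists_disjoint_thicken`). Finally, paths inside the sets form the embedding
(`MetricGraph.exists_isThickEmbedding`), where disjointness of vertex sets becomes distance at least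
`1`. The diameter is governed by the size of one set, the volume by the sum of all sizes. -/

/-- Some walk from `a` to `b` has all its vertices in `A`. -/
def LinkedIn (G : SimpleGraph V) (A : Set V) (a b : V) : Prop :=
  ∃ p : G.Walk a b, ∀ v ∈ p.support, v ∈ A

namespace LinkedIn

variable {A B : Set V} {a b c : V}

theorem refl (h : a ∈ A) : G.LinkedIn A a a := ⟨.nil, by simpa⟩

theorem source_mem (h : G.LinkedIn A a b) : a ∈ A := h.elim fun p hp => hp _ p.start_mem_support

theorem symm (h : G.LinkedIn A a b) : G.LinkedIn A b a :=
  h.elim fun p hp => ⟨p.reverse, fun v hv => hp v (by simpa using hv)⟩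

theorem target_mem (h : G.LinkedIn A a b) : b ∈ A := h.symm.source_mem

theorem trans (h : G.LinkedIn A a b) (h' : G.LinkedIn A b c) : G.LinkedIn A a c := by
  obtain ⟨p, hp⟩ := h
  obtain ⟨q, hq⟩ := h'
  refine ⟨p.append q, fun v hv => ?_⟩
  rcases (Walk.mem_support_append_iff p q).1 hv with hv | hv
  exacts [hp v hv, hq v hv]

theorem mono (hAB : A ⊆ B) (h : G.LinkedIn A a b) : G.LinkedIn B a b :=
  h.elim fun p hp => ⟨p, fun v hv => hAB (hp v hv)⟩

theorem of_adj (h : G.Adj a b) (ha : a ∈ A) (hb : b ∈ A) : G.LinkedIn A a b :=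
  ⟨h.toWalk, by simp [ha, hb]⟩

/-- Induction along a path inside `A`, starting from its end. -/
theorem induction_on {P : V → Prop} (h : G.LinkedIn A a b) (hb : P b)
    (step : ∀ u v, u ∈ A → v ∈ A → G.Adj u v → P v → P u) : P a := by
  obtain ⟨p, hp⟩ := h
  induction p with
  | nil => exact hb
  | cons huv q ih =>
    have hq : ∀ w ∈ q.support, w ∈ A := fun w hw => hp w (by simp [hw])
    exact step _ _ (hp _ (by simp)) (hq _ q.start_mem_support) huv (ih hb hq)

/-- A walk without repetitions visits each element of `A` at most once. This turns cardinality
bounds into distance bounds. -/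
theorem exists_length_lt {A : Finset V} (h : G.LinkedIn (A : Set V) a b) :
    ∃ p : G.Walk a b, p.length < A.card := by
  classical
  obtain ⟨p, hp⟩ := h
  refine ⟨p.bypass, ?_⟩
  have h1 : p.bypass.support.toFinset ⊆ A := fun v hv =>
    hp v (p.support_bypass_subset_support (by simpa using hv))
  have h2 := Finset.card_le_card h1
  rw [List.toFinset_card_of_nodup p.bypass_isPath.support_nodup, Walk.length_support] at h2
  omega

end LinkedIn

end SimpleGraph

/-! ### Functions and subsets of a metric graph -/

namespace MetricGraph

variable {V : Type*} {G : SimpleGraph V}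

/-- A vertex as a point of the metric graph. -/
def vertex (v : V) : MetricGraph G := Realization.vertex v

theorem edge_zero (d : G.Dart) : edge d 0 = vertex d.fst := Quot.sound (.source d)

theorem edge_one (d : G.Dart) : edge d 1 = vertex d.snd := Quot.sound (.target d)

theorem eq_vertex_or_edge (x : MetricGraph G) :
    (∃ v, x = vertex v) ∨ ∃ d t, x = edge d t := by
  induction x using Quot.ind with
  | mk x => rcases x with v | ⟨d, t⟩
            exacts [.inl ⟨v, rfl⟩, .inr ⟨d, t, rfl⟩]

/-- The extension of a function on the vertices that is affine on the edges. -/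
noncomputable def affineExt (h : V → ℝ) : MetricGraph G → ℝ :=
  Quot.lift (Sum.elim h fun p => (1 - (p.2 : ℝ)) * h p.1.fst + p.2 * h p.1.snd) (by
    intro x y hxy
    induction hxy with
    | source d => simp
    | target d => simp
    | symm d t => simp; ring)

theorem affineExt_vertex (h : V → ℝ) (v : V) : affineExt (G := G) h (vertex v) = h v := rfl

theorem affineExt_edge (h : V → ℝ) (d : G.Dart) (t : I) :
    affineExt h (edge d t) = (1 - (t : ℝ)) * h d.fst + t * h d.snd := rfl

/-- The source of all lower bounds for distances: a function that changes by at most `1` along edges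
is `1`-Lipschitz for the path metric after affine extension. -/
theorem abs_affineExt_sub_le_of_hasPath {h : V → ℝ} (hh : ∀ u v, G.Adj u v → |h u - h v| ≤ 1)
    {x y : MetricGraph G} {l : ℝ≥0} (p : HasPath x y l) :
    |affineExt h x - affineExt h y| ≤ l := by
  induction p with
  | nil x => simp
  | cons d s t y l _ ih =>
    have h1 : affineExt h (edge d s) - affineExt h (edge d t)
        = ((s : ℝ) - t) * (h d.snd - h d.fst) := by
      rw [affineExt_edge, affineExt_edge]; ring
    have h2 : |affineExt h (edge d s) - affineExt h (edge d t)| ≤ |(s : ℝ) - t| := by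
      rw [h1, abs_mul]
      exact mul_le_of_le_one_right (abs_nonneg _) (hh _ _ d.adj.symm)
    have h3 : ((nndist s t : ℝ≥0) : ℝ) = |(s : ℝ) - t| := by
      rw [coe_nndist, Subtype.dist_eq, Real.dist_eq]
    calc _ ≤ _ := abs_sub_le _ (affineExt h (edge d t)) _
      _ ≤ _ := by push_cast [h3]; exact add_le_add h2 ih

theorem ofReal_abs_affineExt_sub_le {h : V → ℝ} (hh : ∀ u v, G.Adj u v → |h u - h v| ≤ 1)
    (x y : MetricGraph G) : ENNReal.ofReal |affineExt h x - affineExt h y| ≤ edist x y := by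
  refine le_iInf₂ fun l p => ?_
  rw [← ENNReal.ofReal_coe_nnreal]
  exact ENNReal.ofReal_le_ofReal (abs_affineExt_sub_le_of_hasPath hh p)

theorem edist_edge_le (d : G.Dart) (s t : I) : edist (edge d s) (edge d t) ≤ edist s t := by
  refine (iInf₂_le_of_le (nndist s t + 0) (.cons d s t _ 0 (.nil _)) le_rfl).trans ?_
  rw [add_zero, edist_nndist]

theorem edist_edge_le_one (d : G.Dart) (s t : I) : edist (edge d s) (edge d t) ≤ 1 := by
  refine (edist_edge_le d s t).trans ?_
  rw [edist_dist, Subtype.dist_eq, Real.dist_eq, ← ENNReal.ofReal_one]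
  refine ENNReal.ofReal_le_ofReal (abs_le.2 ⟨?_, ?_⟩) <;>
    linarith [s.2.1, s.2.2, t.2.1, t.2.2]

theorem continuous_edge (d : G.Dart) : Continuous (edge d) :=
  (LipschitzWith.of_edist_le (edist_edge_le d)).continuous

theorem edist_vertex_le_length {u v : V} (p : G.Walk u v) :
    edist (vertex u : MetricGraph G) (vertex v) ≤ p.length := by
  induction p with
  | nil => simp
  | @cons u w v huw q ih =>
    have h1 : edist (vertex u : MetricGraph G) (vertex w) ≤ 1 := by
      have := edist_edge_le_one (⟨(u, w), huw⟩ : G.Dart) 0 1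
      rwa [edge_zero, edge_one] at this
    calc _ ≤ _ := edist_triangle _ (vertex w) _
      _ ≤ 1 + (q.length : ℝ≥0∞) := add_le_add h1 ih
      _ = _ := by rw [SimpleGraph.Walk.length_cons]; push_cast; ring

theorem edist_vertex_le_card {A : Finset V} {u v : V} (h : G.LinkedIn (A : Set V) u v) :
    edist (vertex u : MetricGraph G) (vertex v) ≤ A.card :=
  h.exists_length_lt.elim fun p hp => (edist_vertex_le_length p).trans (by exact_mod_cast hp.le)

/-- The subgraph spanned by a set of vertices, as a set of points. -/
def span (A : Set V) : Set (MetricGraph G) := {x | affineExt (Aᶜ.indicator 1) x = 0}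

theorem vertex_mem_span {A : Set V} {v : V} : (vertex v : MetricGraph G) ∈ span A ↔ v ∈ A := by
  by_cases h : v ∈ A <;> simp [span, affineExt_vertex, h]

theorem edge_mem_span {A : Set V} {d : G.Dart} (h1 : d.fst ∈ A) (h2 : d.snd ∈ A) (t : I) :
    edge d t ∈ span A := by
  simp [span, affineExt_edge, h1, h2]

theorem endpoint_mem_of_edge_mem_span {A : Set V} {d : G.Dart} {t : I} (h : edge d t ∈ span A) :
    (d.fst ∈ A ∨ t = 1) ∧ (d.snd ∈ A ∨ t = 0) := by
  have h0 : (1 - (t : ℝ)) * Aᶜ.indicator 1 d.fst + t * Aᶜ.indicator 1 d.snd = (0 : ℝ) := h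
  have p1 : 0 ≤ Aᶜ.indicator (1 : V → ℝ) d.fst := indicator_nonneg (by simp) _
  have p2 : 0 ≤ Aᶜ.indicator (1 : V → ℝ) d.snd := indicator_nonneg (by simp) _
  have q1 : 0 ≤ 1 - (t : ℝ) := by linarith [t.2.2]
  have := (add_eq_zero_iff_of_nonneg (mul_nonneg q1 p1) (mul_nonneg t.2.1 p2)).1 h0
  constructor
  · by_contra! hc
    have := this.1
    simp [hc.1, sub_eq_zero] at this
    exact hc.2 (Subtype.ext this.symm)
  · by_contra! hc
    have := this.2
    simp [hc.1] at this
    exact hc.2 this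

theorem span_mono {A B : Set V} (h : A ⊆ B) : (span A : Set (MetricGraph G)) ⊆ span B := by
  intro x hx
  rcases eq_vertex_or_edge x with ⟨v, rfl⟩ | ⟨d, t, rfl⟩
  · exact vertex_mem_span.2 (h (vertex_mem_span.1 hx))
  · obtain ⟨h1, h2⟩ := endpoint_mem_of_edge_mem_span hx
    by_cases ht1 : t = 1
    · subst ht1
      rw [edge_one, vertex_mem_span]
      exact h (h2.resolve_right (by simp))
    by_cases ht0 : t = 0
    · subst ht0
      rw [edge_zero, vertex_mem_span]
      exact h (h1.resolve_right (by simp))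
    exact edge_mem_span (h (h1.resolve_right ht1)) (h (h2.resolve_right ht0)) t

theorem exists_edist_vertex_le_one {A : Set V} {x : MetricGraph G} (hx : x ∈ span A) :
    ∃ a ∈ A, edist x (vertex a) ≤ 1 := by
  rcases eq_vertex_or_edge x with ⟨v, rfl⟩ | ⟨d, t, rfl⟩
  · exact ⟨v, vertex_mem_span.1 hx, by simp⟩
  · by_cases h : d.fst ∈ A
    · exact ⟨_, h, by rw [← edge_zero]; exact edist_edge_le_one _ _ _⟩
    · obtain ⟨h1, h2⟩ := endpoint_mem_of_edge_mem_span hx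
      have ht := h1.resolve_left h
      subst ht
      exact ⟨_, h2.resolve_right (by simp), by rw [← edge_one]; simp⟩

/-- The affine extension of the indicator of `Aᶜ` is `1`-Lipschitz, vanishes on `span A` and equals
`1` on `span B`. -/
theorem one_le_edist_of_disjoint {A B : Set V} (hAB : Disjoint A B) {x y : MetricGraph G}
    (hx : x ∈ span A) (hy : y ∈ span B) : 1 ≤ edist x y := by
  have hy' : y ∈ span Aᶜ := span_mono hAB.subset_compl_left hy
  have h1 : affineExt (Aᶜ.indicator 1) y = 1 := by
    have h2 : affineExt (Aᶜᶜ.indicator 1) y = 0 := hy'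
    have h3 : affineExt (Aᶜ.indicator 1) y + affineExt (Aᶜᶜ.indicator 1) y = 1 := by
      have h4 : ∀ v, Aᶜ.indicator (1 : V → ℝ) v + Aᶜᶜ.indicator (1 : V → ℝ) v = 1 := fun v => by
        by_cases h : v ∈ A <;> simp [h]
      rcases eq_vertex_or_edge y with ⟨v, rfl⟩ | ⟨d, t, rfl⟩
      · exact h4 v
      · rw [affineExt_edge, affineExt_edge]
        linear_combination (1 - (t : ℝ)) * h4 d.fst + t * h4 d.snd
    linarith
  have h5 := ofReal_abs_affineExt_sub_le (G := G) (h := Aᶜ.indicator 1) (fun u v _ => by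
    by_cases hu : u ∈ A <;> by_cases hv : v ∈ A <;> simp [hu, hv]) x y
  have hx0 : affineExt (Aᶜ.indicator 1) x = 0 := hx
  simpa [h1, hx0] using h5

theorem joinedIn_span {A : Set V} {u v : V} (h : G.LinkedIn A u v) :
    JoinedIn (span A : Set (MetricGraph G)) (vertex u) (vertex v) := by
  refine h.induction_on (P := fun w => JoinedIn (span A : Set (MetricGraph G)) (vertex w) (vertex v))
    (.refl (vertex_mem_span.2 h.target_mem)) fun a b ha hb hab ih => ?_
  refine JoinedIn.trans ⟨⟨⟨edge ⟨(a, b), hab⟩, continuous_edge _⟩, ?_, ?_⟩, fun t => ?_⟩ ih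
  · exact edge_zero _
  · exact edge_one _
  · exact edge_mem_span ha hb t

end MetricGraph

/-! ### Volume of neighbourhoods, and thick embeddings from disjoint connected sets -/

namespace MetricGraph

variable {W : Type*} {H : SimpleGraph W}

theorem dartOfEdge_edge (e : H.edgeSet) : (dartOfEdge e).edge = e.1 := Quot.out_eq e.1

theorem measurableSet_affineExt_le (h : W → ℝ) (c : ℝ) :
    MeasurableSet {x : MetricGraph H | affineExt h x ≤ c} := by
  intro d
  refine (IsClosed.measurableSet ?_).nullMeasurableSet
  have : edge d ⁻¹' {x : MetricGraph H | affineExt h x ≤ c}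
      = {t : I | (1 - (t : ℝ)) * h d.fst + t * h d.snd ≤ c} := rfl
  rw [this]
  exact isClosed_le (by fun_prop) continuous_const

/-- In a graph of bounded degree, the `1`-neighbourhood of a subgraph with few vertices has
small length. -/
theorem lengthMeasure_cthickening_le {nb : W → Finset W} (hnb : ∀ v w, H.Adj v w → w ∈ nb v)
    {D : ℕ} (hD : ∀ v, (nb v).card ≤ D) (A : Finset W) {s : Set (MetricGraph H)}
    (hs : s ⊆ span (A : Set W)) :
    lengthMeasure (Metric.cthickening 1 s) ≤ ((A.card * (D + 1) * D : ℕ) : ℝ≥0∞) := by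
  classical
  set B : Finset W := A.biUnion fun a => insert a (nb a) with hB
  set F : Finset (Sym2 W) := B.biUnion fun v => (nb v).image fun w => s(v, w) with hF
  have hAB : ∀ a ∈ A, a ∈ B := fun a ha => by
    rw [hB, Finset.mem_biUnion]; exact ⟨a, ha, by simp⟩
  have hABn : ∀ a ∈ A, ∀ b, H.Adj a b → b ∈ B := fun a ha b hb => by
    rw [hB, Finset.mem_biUnion]; exact ⟨a, ha, by simp [hnb a b hb]⟩
  have hcard : F.card ≤ A.card * (D + 1) * D := by
    refine (Finset.card_biUnion_le_card_mul _ _ D fun v _ => ?_).trans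
      (Nat.mul_le_mul_right _ (Finset.card_biUnion_le_card_mul _ _ (D + 1) fun a _ => ?_))
    · exact Finset.card_image_le.trans (hD v)
    · exact (Finset.card_insert_le _ _).trans (Nat.succ_le_succ (hD a))
  -- A truncated distance to `A`. Its sublevel set at `1` contains the closed `1`-neighbourhood,
  -- while it is constantly `2` on every edge with no end in `B`, so only the edges in `F`
  -- contribute length.
  set g : W → ℝ := fun v => if v ∈ A then 0 else if v ∈ B then 1 else 2 with hg
  have hg1 : ∀ u v, H.Adj u v → |g u - g v| ≤ 1 := by
    have key : ∀ u v, H.Adj u v → g u ≤ g v + 1 := by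
      intro u v huv
      by_cases hv : v ∈ A
      · have hu : u ∈ B := hABn v hv u huv.symm
        simp only [hg, hv, hu, if_true]; split_ifs <;> norm_num
      · have h1 : 1 ≤ g v := by simp only [hg, hv, if_false]; split_ifs <;> norm_num
        have h2 : g u ≤ 2 := by simp only [hg]; split_ifs <;> norm_num
        linarith
    intro u v huv
    rw [abs_le]
    constructor <;> linarith [key u v huv, key v u huv.symm]
  have hg0 : ∀ x ∈ s, affineExt g x = 0 := by
    intro x hx
    have hgA : ∀ a ∈ A, g a = 0 := fun a ha => by simp [hg, ha]
    rcases eq_vertex_or_edge x with ⟨v, rfl⟩ | ⟨d, t, rfl⟩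
    · exact hgA v (by simpa using vertex_mem_span.1 (hs hx))
    · obtain ⟨h1, h2⟩ := endpoint_mem_of_edge_mem_span (hs hx)
      rw [affineExt_edge]
      have e1 : (1 - (t : ℝ)) * g d.fst = 0 := by
        rcases h1 with h1 | h1
        · rw [hgA _ (by simpa using h1), mul_zero]
        · simp [h1]
      have e2 : (t : ℝ) * g d.snd = 0 := by
        rcases h2 with h2 | h2
        · rw [hgA _ (by simpa using h2), mul_zero]
        · simp [h2]
      rw [e1, e2, add_zero]
  have hsub : Metric.cthickening 1 s ⊆ {x | affineExt g x ≤ 1} := by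
    intro x hx
    rw [Metric.mem_cthickening_iff] at hx
    have h1 : ENNReal.ofReal (affineExt g x) ≤ Metric.infEDist x s := by
      refine Metric.le_infEDist.2 fun y hy => ?_
      refine le_trans (ENNReal.ofReal_le_ofReal ?_) (ofReal_abs_affineExt_sub_le hg1 x y)
      rw [hg0 y hy, sub_zero]
      exact le_abs_self _
    exact (ENNReal.ofReal_le_ofReal_iff zero_le_one).1 (h1.trans hx)
  refine (measure_mono hsub).trans ?_
  rw [lengthMeasure_apply (measurableSet_affineExt_le g 1)]
  have hterm : ∀ e : H.edgeSet, volume (edge (dartOfEdge e) ⁻¹' {x | affineExt g x ≤ 1})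
      ≤ (fun e : Sym2 W => if e ∈ F then (1 : ℝ≥0∞) else 0) e.1 := by
    intro e
    by_cases he : e.1 ∈ F
    · simp only [he, if_true]
      exact prob_le_one
    · simp only [he, if_false, nonpos_iff_eq_zero]
      have hadj := (dartOfEdge e).adj
      have hmem : ∀ u v, H.Adj u v → s(u, v) = e.1 → u ∉ B := fun u v huv hs hu => he (by
        rw [hF, Finset.mem_biUnion, ← hs]
        exact ⟨u, hu, Finset.mem_image.2 ⟨v, hnb u v huv, rfl⟩⟩)
      have hB1 := hmem _ _ hadj (dartOfEdge_edge e)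
      have hB2 := hmem _ _ hadj.symm (Sym2.eq_swap.trans (dartOfEdge_edge e))
      have hval : ∀ v, v ∉ B → g v = 2 := fun v hv => by
        simp [hg, hv, show v ∉ A from fun h => hv (hAB v h)]
      convert measure_empty (μ := (volume : Measure I))
      ext t
      simp only [mem_preimage, mem_ofPred_eq, affineExt_edge, hval _ hB1, hval _ hB2,
        mem_empty_iff_false, iff_false, not_le]
      linarith
  calc _ ≤ ∑' e : H.edgeSet, (fun e : Sym2 W => if e ∈ F then (1 : ℝ≥0∞) else 0) e.1 :=
        ENNReal.tsum_le_tsum hterm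
    _ ≤ ∑' e : Sym2 W, if e ∈ F then (1 : ℝ≥0∞) else 0 :=
        ENNReal.tsum_comp_le_tsum_of_injective Subtype.val_injective _
    _ = F.card := by
        rw [tsum_eq_sum (s := F) fun e he => by simp [he]]
        simp
    _ ≤ _ := by exact_mod_cast hcard

/-- Vertex-disjoint connected subgraphs for the edges of `G` give a thick embedding. -/
theorem exists_isThickEmbedding {V : Type*} [Fintype V] {G : SimpleGraph V} [Fintype G.edgeSet]
    {nb : W → Finset W} (hnb : ∀ v w, H.Adj v w → w ∈ nb v) {D : ℕ} (hD : ∀ v, (nb v).card ≤ D)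
    {φ : V → W} (hφ : Function.Injective φ) {A : Sym2 V → Finset W}
    (hA : ∀ e ∈ G.edgeSet, ∀ a ∈ A e, ∀ b ∈ A e, H.LinkedIn (A e : Set W) a b)
    (hmem : ∀ e ∈ G.edgeSet, ∀ v ∈ e, φ v ∈ A e)
    (hdisj : ∀ e ∈ G.edgeSet, ∀ e' ∈ G.edgeSet, (∀ v ∈ e, v ∉ e') → Disjoint (A e) (A e'))
    (hφA : ∀ e ∈ G.edgeSet, ∀ v ∉ e, φ v ∉ A e)
    {m : ℕ} (hm : ∀ e ∈ G.edgeSet, (A e).card ≤ m)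
    (hdist : ∀ u v, edist (vertex (φ u) : MetricGraph H) (vertex (φ v)) ≤ m) :
    ∃ f : Realization G → MetricGraph H, IsThickEmbedding 1 f ∧
      Metric.ediam (range f) ≤ ((3 * m + 2 : ℕ) : ℝ≥0∞) ∧
      thickVolume lengthMeasure f ≤
        (((Fintype.card V + Fintype.card G.edgeSet * m) * (D + 1) * D : ℕ) : ℝ≥0∞) := by
  classical
  have hjoin : ∀ d : G.Dart, JoinedIn (span (A d.edge : Set W) : Set (MetricGraph H))
      (vertex (φ d.fst)) (vertex (φ d.snd)) := fun d =>
    joinedIn_span (hA _ d.edge_mem _ (hmem _ d.edge_mem _ (Sym2.mem_mk_left _ _))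
      _ (hmem _ d.edge_mem _ (Sym2.mem_mk_right _ _)))
  let ι := Fintype.equivFin V
  -- The two orientations of an edge must carry the same path run in opposite directions, or the map
  -- would not respect the gluing. An arbitrary ordering of the vertices selects the orientation on
  -- which the path is chosen.
  let γ : ∀ d : G.Dart, Path (vertex (φ d.fst) : MetricGraph H) (vertex (φ d.snd)) := fun d =>
    if ι d.fst < ι d.snd then (hjoin d).somePath else (hjoin d.symm).somePath.symm
  have hpos : ∀ d, ι d.fst < ι d.snd → ∀ t, γ d t = (hjoin d).somePath t := fun d h t =>
    congrArg (fun p : Path _ _ => p t) (if_pos h)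
  have hneg : ∀ d, ¬ ι d.fst < ι d.snd → ∀ t,
      γ d t = (hjoin d.symm).somePath (unitInterval.symm t) := fun d h t =>
    congrArg (fun p : Path _ _ => p t) (if_neg h)
  have hγ : ∀ d t, γ d t ∈ (span (A d.edge : Set W) : Set (MetricGraph H)) := by
    intro d t
    by_cases h : ι d.fst < ι d.snd
    · rw [hpos d h]; exact (hjoin d).somePath_mem t
    · rw [hneg d h, ← SimpleGraph.Dart.edge_symm]
      exact (hjoin d.symm).somePath_mem (unitInterval.symm t)
  have hsymm : ∀ d t, γ d t = γ d.symm (unitInterval.symm t) := by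
    intro d t
    have hne : ι d.fst ≠ ι d.snd := fun h => d.adj.ne (ι.injective h)
    by_cases h : ι d.fst < ι d.snd
    · rw [hpos d h, hneg d.symm (not_lt.2 h.le), unitInterval.symm_symm]
      rfl
    · rw [hneg d h, hpos d.symm (lt_of_le_of_ne (not_lt.1 h) hne.symm)]
  let f : Realization G → MetricGraph H :=
    Quot.lift (Sum.elim (fun v => vertex (φ v)) fun p => γ p.1 p.2) (by
      intro x y hxy
      induction hxy with
      | source d => exact (γ d).source
      | target d => exact (γ d).target
      | symm d t => exact hsymm d t)
  have hfv : ∀ v, f (.vertex v) = vertex (φ v) := fun v => rfl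
  have hfe : ∀ d t, f (.edge d t) = γ d t := fun d t => rfl
  have hrange : ∀ y ∈ range f, (∃ v, y = vertex (φ v)) ∨ ∃ d : G.Dart,
      y ∈ (span (A d.edge : Set W) : Set (MetricGraph H)) := by
    rintro _ ⟨x, rfl⟩
    induction x using Quot.ind with
    | mk x =>
      rcases x with v | ⟨d, t⟩
      exacts [.inl ⟨v, rfl⟩, .inr ⟨d, hγ d t⟩]
  refine ⟨f, ⟨?_, ?_, ?_, ?_⟩, ?_, ?_⟩
  · refine continuous_iSup_dom.2 fun d => continuous_coinduced_dom.2 ?_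
    exact (γ d).continuous
  · intro u v huv
    exact one_le_edist_of_disjoint (A := {φ u}) (B := {φ v}) (by simpa using hφ.ne huv)
      (vertex_mem_span.2 rfl) (vertex_mem_span.2 rfl)
  · intro v d hv t
    exact one_le_edist_of_disjoint (A := {φ v}) (by simpa using hφA _ d.edge_mem v hv)
      (vertex_mem_span.2 rfl) (hγ d t)
  · intro d d' hdd s t
    exact one_le_edist_of_disjoint
      (by exact_mod_cast hdisj _ d.edge_mem _ d'.edge_mem hdd) (hγ d s) (hγ d' t)
  -- Every image point is within `1 + m` of the image of a vertex, and these are within `m` of each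
  -- other.
  · have hnear : ∀ y ∈ range f, ∃ v, edist y (vertex (φ v)) ≤ 1 + m := by
      intro y hy
      rcases hrange y hy with ⟨v, rfl⟩ | ⟨d, hd⟩
      · exact ⟨v, by simp⟩
      · obtain ⟨a, ha, hya⟩ := exists_edist_vertex_le_one hd
        refine ⟨d.fst, (edist_triangle _ (vertex a) _).trans (add_le_add hya ?_)⟩
        refine (edist_vertex_le_card (hA _ d.edge_mem a ha _
          (hmem _ d.edge_mem _ (Sym2.mem_mk_left _ _)))).trans ?_
        exact_mod_cast hm _ d.edge_mem
    refine Metric.ediam_le fun x hx y hy => ?_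
    obtain ⟨u, hu⟩ := hnear x hx
    obtain ⟨v, hv⟩ := hnear y hy
    calc edist x y ≤ edist x (vertex (φ u)) + edist (vertex (φ u)) y := edist_triangle _ _ _
      _ ≤ edist x (vertex (φ u)) + (edist (vertex (φ u) : MetricGraph H) (vertex (φ v))
            + edist (vertex (φ v)) y) := by gcongr; exact edist_triangle _ _ _
      _ ≤ (1 + m) + (m + (1 + m)) := by
          gcongr
          · exact hdist u v
          · rwa [edist_comm]
      _ = _ := by push_cast; ring
  · set B : Finset W := Finset.univ.image φ ∪ G.edgeFinset.biUnion A with hB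
    have hsub : range f ⊆ span (B : Set W) := by
      intro y hy
      rcases hrange y hy with ⟨v, rfl⟩ | ⟨d, hd⟩
      · exact vertex_mem_span.2 (by simp [hB])
      · refine span_mono ?_ hd
        intro w hw
        rw [hB]
        simp only [Finset.coe_union, mem_union, Finset.mem_coe, Finset.mem_biUnion]
        exact .inr ⟨d.edge, by simp, hw⟩
    refine (lengthMeasure_cthickening_le hnb hD B hsub).trans ?_
    have hBc : B.card ≤ Fintype.card V + Fintype.card G.edgeSet * m := by
      refine (Finset.card_union_le _ _).trans (add_le_add Finset.card_image_le ?_)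
      rw [← SimpleGraph.edgeFinset_card]
      exact Finset.card_biUnion_le_card_mul _ _ m fun e he => hm e (by simpa using he)
    exact_mod_cast Nat.mul_le_mul_right _ (Nat.mul_le_mul_right _ hBc)

end MetricGraph

/-! ### Choices with small loads and colourings -/

section Choice

variable {E ι R : Type*} [Fintype E] [DecidableEq R]

/-- If every `e` picks one of the elements of `Ω` at random and every resource has bounded
expected load, then for some choice all loads are logarithmic in the number of resources. -/
theorem exists_choice_two_pow_load_le (Ω : Finset ι) (hΩ : Ω.Nonempty) (U : E → ι → Finset R)
    (S : Finset R) (c : ℝ)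
    (hc : ∀ r, (∑ e, ((Ω.filter fun w => r ∈ U e w).card : ℝ)) ≤ c * Ω.card) :
    ∃ f : E → ι, (∀ e, f e ∈ Ω) ∧ ∀ r ∈ S,
      (2 : ℝ) ^ (Finset.univ.filter fun e => r ∈ U e (f e)).card ≤ S.card * Real.exp c := by
  classical
  have hΩ0 : (0 : ℝ) < Ω.card := by exact_mod_cast hΩ.card_pos
  set P := Fintype.piFinset fun _ : E => Ω with hP
  have hPne : P.Nonempty := by
    obtain ⟨w, hw⟩ := hΩ
    exact ⟨fun _ => w, Fintype.mem_piFinset.2 fun _ => hw⟩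
  -- The sum over the resources of `2` to the power of the load. By independence its mean is at most
  -- `S.card * exp c`, and a choice not exceeding the mean bounds each summand separately.
  let Φ : (E → ι) → ℝ := fun f => ∑ r ∈ S, ∏ e, if r ∈ U e (f e) then (2 : ℝ) else 1
  have hr : ∀ r, ∑ f ∈ P, ∏ e, (if r ∈ U e (f e) then (2 : ℝ) else 1)
      ≤ P.card * Real.exp c := by
    intro r
    have h1 : ∀ e, ∑ w ∈ Ω, (if r ∈ U e w then (2 : ℝ) else 1)
        ≤ Ω.card * Real.exp ((Ω.filter fun w => r ∈ U e w).card / Ω.card) := by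
      intro e
      have : ∑ w ∈ Ω, (if r ∈ U e w then (2 : ℝ) else 1)
          = Ω.card + (Ω.filter fun w => r ∈ U e w).card := by
        have : ∀ w, (if r ∈ U e w then (2 : ℝ) else 1) = 1 + if r ∈ U e w then (1 : ℝ) else 0 :=
          fun w => by split_ifs <;> norm_num
        simp only [this, Finset.sum_add_distrib]
        simp
      rw [this]
      refine le_trans (le_of_eq ?_) (mul_le_mul_of_nonneg_left (Real.add_one_le_exp _) hΩ0.le)
      field_simp
      ring
    -- Independence of the choices: the sum over all choice functions of a product is the product of
    -- the sums.
    rw [hP, ← Finset.prod_univ_sum (fun _ : E => Ω) fun e w => if r ∈ U e w then (2 : ℝ) else 1]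
    calc _ ≤ ∏ e, ((Ω.card : ℝ) * Real.exp ((Ω.filter fun w => r ∈ U e w).card / Ω.card)) :=
          Finset.prod_le_prod (fun e _ => Finset.sum_nonneg fun w _ => by split_ifs <;> norm_num)
            fun e _ => h1 e
      _ = ((Fintype.piFinset fun _ : E => Ω).card : ℝ) *
            Real.exp ((∑ e, ((Ω.filter fun w => r ∈ U e w).card : ℝ)) / Ω.card) := by
          rw [Finset.prod_mul_distrib, ← Real.exp_sum, Finset.sum_div, Fintype.card_piFinset]
          push_cast
          rfl
      _ ≤ _ := by
          gcongr
          rw [div_le_iff₀ hΩ0]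
          exact hc r
  have htot : ∑ f ∈ P, Φ f ≤ ∑ f ∈ P, S.card * Real.exp c := by
    rw [Finset.sum_comm]
    calc _ ≤ ∑ r ∈ S, P.card * Real.exp c := Finset.sum_le_sum fun r _ => hr r
      _ = _ := by simp only [Finset.sum_const, nsmul_eq_mul]; ring
  obtain ⟨f, hf, hle⟩ := Finset.exists_le_of_sum_le hPne htot
  refine ⟨f, Fintype.mem_piFinset.1 hf, fun r hrS => le_trans ?_ hle⟩
  have h2 : (2 : ℝ) ^ (Finset.univ.filter fun e => r ∈ U e (f e)).card
      = ∏ e, if r ∈ U e (f e) then (2 : ℝ) else 1 := by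
    rw [Finset.prod_ite, Finset.prod_const, Finset.prod_const_one, mul_one]
  rw [h2]
  exact Finset.single_le_sum (f := fun r => ∏ e, if r ∈ U e (f e) then (2 : ℝ) else 1)
    (fun r _ => Finset.prod_nonneg fun e _ => by split_ifs <;> norm_num) hrS

/-- Greedy colouring: a symmetric relation in which every element is related to at most `D`
elements has a proper colouring with `D + 1` colours. -/
theorem exists_coloring_of_degree_le (r : E → E → Prop) (hr : ∀ a b, r a b → r b a) (D : ℕ)
    (hD : ∀ a, {b | r a b}.ncard ≤ D) :
    ∃ χ : E → ℕ, (∀ e, χ e ≤ D) ∧ ∀ a b, a ≠ b → r a b → χ a ≠ χ b := by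
  classical
  suffices h : ∀ T : Finset E, ∃ χ : E → ℕ, (∀ e, χ e ≤ D) ∧
      ∀ a ∈ T, ∀ b ∈ T, a ≠ b → r a b → χ a ≠ χ b by
    obtain ⟨χ, h1, h2⟩ := h Finset.univ
    exact ⟨χ, h1, fun a b => h2 a (Finset.mem_univ _) b (Finset.mem_univ _)⟩
  intro T
  induction T using Finset.induction_on with
  | empty => exact ⟨fun _ => 0, by simp, by simp⟩
  | insert x T hx ih =>
    obtain ⟨χ, h1, h2⟩ := ih
    -- At most `D` colours occur among the elements related to `x`, so one of the `D + 1` is free.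
    obtain ⟨k, hk, hkn⟩ : ∃ k ∈ Finset.range (D + 1),
        k ∉ (Finset.univ.filter fun b => r x b).image χ := by
      by_contra! hcon
      have h3 := Finset.card_le_card hcon
      have h4 : (Finset.univ.filter fun b => r x b).card ≤ D := by
        rw [← Set.ncard_coe_finset]; simpa using hD x
      rw [Finset.card_range] at h3
      have := h3.trans Finset.card_image_le
      omega
    have hk' : ∀ b, r x b → χ b ≠ k := fun b hb h =>
      hkn (Finset.mem_image.2 ⟨b, by simpa using hb, h⟩)
    refine ⟨Function.update χ x k, fun e => ?_, fun a ha b hb hab hrab => ?_⟩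
    · by_cases he : e = x
      · subst he; simpa [Nat.lt_succ_iff] using hk
      · simpa [he] using h1 e
    · rcases Finset.mem_insert.1 ha with rfl | ha <;> rcases Finset.mem_insert.1 hb with rfl | hb
      · exact absurd rfl hab
      · rw [Function.update_self, Function.update_of_ne hab.symm]
        exact (hk' b hrab).symm
      · rw [Function.update_self, Function.update_of_ne hab]
        exact hk' a (hr _ _ hrab)
      · have hax : a ≠ x := fun h => hx (h ▸ ha)
        have hbx : b ≠ x := fun h => hx (h ▸ hb)
        rw [Function.update_of_ne hax, Function.update_of_ne hbx]
        exact h2 a ha b hb hab hrab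

end Choice

/-! ### From the standard Cayley graph to an arbitrary one -/

theorem Int.eq_zero_of_abs_mul_lt {k z : ℤ} (h : |k * z| < k) : z = 0 := by
  by_contra hz
  have h1 : 1 ≤ |z| := Int.one_le_abs hz
  rw [abs_mul] at h
  nlinarith [le_abs_self k, abs_nonneg k]

namespace SimpleGraph

variable {M : Type*} [Group M] {S : Set M}

theorem reachable_mulCayley (hS : Subgroup.closure S = ⊤) (g : M) :
    (mulCayley S).Reachable 1 g := by
  -- An arbitrary base point is needed for the induction through products and inverses.
  have h : ∀ g ∈ Subgroup.closure S, ∀ h, (mulCayley S).Reachable h (h * g) := by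
    intro g hg
    induction hg using Subgroup.closure_induction with
    | mem x hx =>
      intro h
      by_cases hne : h = h * x
      · rw [← hne]
      · exact Adj.reachable ((mulCayley_adj' S _ _).2 ⟨hne, x, hx, .inl rfl⟩)
    | one => intro h; rw [mul_one]
    | mul x y _ _ hx hy => intro h; rw [← mul_assoc]; exact (hx h).trans (hy _)
    | inv x _ hx => intro h; simpa using (hx (h * x⁻¹)).symm
  simpa using h g (hS ▸ Subgroup.mem_top g) 1

theorem LinkedIn.mul_left {A : Set M} {a b : M} (h : (mulCayley S).LinkedIn A a b) (g : M) :
    (mulCayley S).LinkedIn ((g * ·) '' A) (g * a) (g * b) :=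
  h.induction_on (P := fun u => (mulCayley S).LinkedIn ((g * ·) '' A) (g * u) (g * b))
    (.refl ⟨b, h.target_mem, rfl⟩) fun u v hu hv huv ih =>
      .trans (.of_adj ((mulCayley_adj_mul_iff_right (d := g)).2 huv) ⟨u, hu, rfl⟩ ⟨v, hv, rfl⟩) ih

theorem Reachable.exists_linkedIn {V : Type*} {G : SimpleGraph V} {a b : V}
    (h : G.Reachable a b) :
    ∃ B : Finset V, b ∈ B ∧ ∀ c ∈ B, G.LinkedIn (B : Set V) a c := by
  classical
  obtain ⟨p⟩ := h
  refine ⟨p.support.toFinset, by simp, fun c hc => ?_⟩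
  have hc' : c ∈ p.support := by simpa using hc
  exact ⟨p.takeUntil c hc', fun v hv => by
    simpa using p.support_takeUntil_subset_support hc' hv⟩

/-- In a connected Cayley graph, any finite set lies in a finite connected set. -/
theorem exists_finset_linkedIn [DecidableEq M] (hS : Subgroup.closure S = ⊤) (T : Finset M) :
    ∃ B : Finset M, T ⊆ B ∧ ∀ c ∈ B, (mulCayley S).LinkedIn (B : Set M) 1 c := by
  choose f hf using fun g => (reachable_mulCayley hS g).exists_linkedIn
  refine ⟨T.biUnion f, fun t ht => Finset.mem_biUnion.2 ⟨t, ht, (hf t).1⟩, fun c hc => ?_⟩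
  obtain ⟨t, ht, hct⟩ := Finset.mem_biUnion.1 hc
  exact ((hf t).2 c hct).mono (by exact_mod_cast Finset.subset_biUnion_of_mem f ht)

end SimpleGraph

/-! ### Dilating and thickening subgraphs of the standard Cayley graph -/

namespace Heisenberg

open SimpleGraph

noncomputable instance : DecidableEq Heisenberg := Classical.decEq _

/-- The powers of the first standard generator. -/
def powX (i : ℤ) : Heisenberg := ⟨i, 0, 0⟩

/-- The powers of the second standard generator. -/
def powY (i : ℤ) : Heisenberg := ⟨0, i, 0⟩

/-- The Cayley graph with respect to the standard generators. -/
def stdGraph : SimpleGraph Heisenberg := mulCayley {powX 1, powY 1}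

theorem stdGraph_adj {p q : Heisenberg} : stdGraph.Adj p q ↔
    (q = p * powX 1 ∨ q = p * powY 1) ∨ p = q * powX 1 ∨ p = q * powY 1 := by
  rw [stdGraph, mulCayley_adj']
  have h : ∀ p : Heisenberg, p ≠ p * powX 1 ∧ p ≠ p * powY 1 := fun p =>
    ⟨fun h => by simpa [powX] using congrArg a h, fun h => by simpa [powY] using congrArg b h⟩
  constructor
  · rintro ⟨-, g, rfl | rfl, rfl | rfl⟩ <;> simp
  · rintro ((rfl | rfl) | rfl | rfl)
    · exact ⟨(h p).1, _, .inl rfl, .inl rfl⟩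
    · exact ⟨(h p).2, _, .inr rfl, .inl rfl⟩
    · exact ⟨(h q).1.symm, _, .inl rfl, .inr rfl⟩
    · exact ⟨(h q).2.symm, _, .inr rfl, .inr rfl⟩

/-- The dilation by the factor `k`. -/
def dilate (k : ℤ) (p : Heisenberg) : Heisenberg := ⟨k * p.a, k * p.b, k ^ 2 * p.c⟩

theorem dilate_injective {k : ℤ} (hk : k ≠ 0) : Function.Injective (dilate k) := by
  intro p q h
  have ha := congrArg a h
  have hb := congrArg b h
  have hc := congrArg c h
  ext
  · exact mul_left_cancel₀ hk ha
  · exact mul_left_cancel₀ hk hb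
  · exact mul_left_cancel₀ (pow_ne_zero 2 hk) hc

/-- The dilated edges of the subgraph spanned by `A`, thickened by `B`. -/
noncomputable def thicken (k : ℕ) (B A : Finset Heisenberg) : Finset Heisenberg :=
  ((A.filter (· * powX 1 ∈ A)) ×ˢ Finset.range (k + 1) ×ˢ B).image
      (fun t => dilate k t.1 * powX t.2.1 * t.2.2) ∪
    ((A.filter (· * powY 1 ∈ A)) ×ˢ Finset.range (k + 1) ×ˢ B).image
      (fun t => dilate k t.1 * powY t.2.1 * t.2.2)

variable {k : ℕ} {A A' B : Finset Heisenberg}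

theorem mem_thicken {g : Heisenberg} : g ∈ thicken k B A ↔
    ∃ p ∈ A, ∃ i : ℕ, i ≤ k ∧ ∃ s ∈ B,
      (p * powX 1 ∈ A ∧ g = dilate k p * powX i * s) ∨
        (p * powY 1 ∈ A ∧ g = dilate k p * powY i * s) := by
  simp only [thicken, Finset.mem_union, Finset.mem_image, Finset.mem_product, Finset.mem_filter,
    Finset.mem_range, Nat.lt_succ_iff, Prod.exists]
  constructor
  · rintro (⟨p, i, s, ⟨⟨hp, hp'⟩, hi, hs⟩, rfl⟩ | ⟨p, i, s, ⟨⟨hp, hp'⟩, hi, hs⟩, rfl⟩)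
    · exact ⟨p, hp, i, hi, s, hs, .inl ⟨hp', rfl⟩⟩
    · exact ⟨p, hp, i, hi, s, hs, .inr ⟨hp', rfl⟩⟩
  · rintro ⟨p, hp, i, hi, s, hs, ⟨hp', rfl⟩ | ⟨hp', rfl⟩⟩
    · exact .inl ⟨p, i, s, ⟨⟨hp, hp'⟩, hi, hs⟩, rfl⟩
    · exact .inr ⟨p, i, s, ⟨⟨hp, hp'⟩, hi, hs⟩, rfl⟩

theorem card_thicken_le : (thicken k B A).card ≤ 2 * ((k + 1) * B.card) * A.card := by
  have h : ∀ (P : Finset Heisenberg) (f : Heisenberg × ℕ × Heisenberg → Heisenberg), P ⊆ A →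
      ((P ×ˢ Finset.range (k + 1) ×ˢ B).image f).card ≤ (k + 1) * B.card * A.card := by
    intro P f hP
    refine Finset.card_image_le.trans ?_
    rw [Finset.card_product, Finset.card_product, Finset.card_range, mul_comm]
    exact Nat.mul_le_mul_left _ (Finset.card_le_card hP)
  refine (Finset.card_union_le _ _).trans ?_
  have h1 := h (A.filter (· * powX 1 ∈ A)) (fun t => dilate k t.1 * powX t.2.1 * t.2.2)
    (Finset.filter_subset _ _)
  have h2 := h (A.filter (· * powY 1 ∈ A)) (fun t => dilate k t.1 * powY t.2.1 * t.2.2)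
    (Finset.filter_subset _ _)
  linarith

section Linked

variable {S : Set Heisenberg}

/-- Each translate of `B` along the segment is connected and, as `powX 1 ∈ B`, contains the base
point of the next one. -/
theorem linkedIn_dilate_mul_powX (hB : ∀ c ∈ B, (mulCayley S).LinkedIn (B : Set Heisenberg) 1 c)
    (hx : powX 1 ∈ B) {p : Heisenberg} (hp : p ∈ A) (hp' : p * powX 1 ∈ A) {i : ℕ} (hi : i ≤ k)
    {s : Heisenberg} (hs : s ∈ B) :
    (mulCayley S).LinkedIn (thicken k B A : Set Heisenberg) (dilate k p)
      (dilate k p * powX i * s) := by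
  have hstep : ∀ i ≤ k, ∀ s ∈ B, (mulCayley S).LinkedIn (thicken k B A : Set Heisenberg)
      (dilate k p * powX i) (dilate k p * powX i * s) := by
    intro i hi s hs
    have := (hB s hs).mul_left (dilate k p * powX i)
    rw [mul_one] at this
    refine this.mono ?_
    rintro _ ⟨c, hc, rfl⟩
    exact mem_thicken.2 ⟨p, hp, i, hi, c, hc, .inl ⟨hp', rfl⟩⟩
  have hline : ∀ i ≤ k, (mulCayley S).LinkedIn (thicken k B A : Set Heisenberg)
      (dilate k p) (dilate k p * powX i) := by
    intro i
    induction i with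
    | zero =>
      intro _
      have h0 : dilate k p * powX (0 : ℕ) = dilate k p := by ext <;> simp [powX]
      have := (hstep 0 (Nat.zero_le _) _ hx).source_mem
      rw [h0] at this ⊢
      exact .refl this
    | succ i ih =>
      intro hi
      refine (ih (Nat.le_of_succ_le hi)).trans ?_
      have h1 : dilate k p * powX (i + 1 : ℕ) = dilate k p * powX i * powX 1 := by
        ext <;> simp [powX]
        ring
      rw [h1]
      exact hstep i (Nat.le_of_succ_le hi) _ hx
  exact (hline i hi).trans (hstep i hi s hs)

theorem linkedIn_dilate_mul_powY (hB : ∀ c ∈ B, (mulCayley S).LinkedIn (B : Set Heisenberg) 1 c)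
    (hy : powY 1 ∈ B) {p : Heisenberg} (hp : p ∈ A) (hp' : p * powY 1 ∈ A) {i : ℕ} (hi : i ≤ k)
    {s : Heisenberg} (hs : s ∈ B) :
    (mulCayley S).LinkedIn (thicken k B A : Set Heisenberg) (dilate k p)
      (dilate k p * powY i * s) := by
  have hstep : ∀ i ≤ k, ∀ s ∈ B, (mulCayley S).LinkedIn (thicken k B A : Set Heisenberg)
      (dilate k p * powY i) (dilate k p * powY i * s) := by
    intro i hi s hs
    have := (hB s hs).mul_left (dilate k p * powY i)
    rw [mul_one] at this
    refine this.mono ?_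
    rintro _ ⟨c, hc, rfl⟩
    exact mem_thicken.2 ⟨p, hp, i, hi, c, hc, .inr ⟨hp', rfl⟩⟩
  have hline : ∀ i ≤ k, (mulCayley S).LinkedIn (thicken k B A : Set Heisenberg)
      (dilate k p) (dilate k p * powY i) := by
    intro i
    induction i with
    | zero =>
      intro _
      have h0 : dilate k p * powY (0 : ℕ) = dilate k p := by ext <;> simp [powY]
      have := (hstep 0 (Nat.zero_le _) _ hy).source_mem
      rw [h0] at this ⊢
      exact .refl this
    | succ i ih =>
      intro hi
      refine (ih (Nat.le_of_succ_le hi)).trans ?_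
      have h1 : dilate k p * powY (i + 1 : ℕ) = dilate k p * powY i * powY 1 := by
        ext <;> simp [powY] <;> ring
      rw [h1]
      exact hstep i (Nat.le_of_succ_le hi) _ hy
  exact (hline i hi).trans (hstep i hi s hs)

/-- The dilation is a group endomorphism, so an edge of the standard graph goes to the ends of a
segment of `k` steps in the same direction, and the thickening covers this segment. -/
theorem linkedIn_thicken_of_adj
    (hB : ∀ c ∈ B, (mulCayley S).LinkedIn (B : Set Heisenberg) 1 c)
    (h1 : 1 ∈ B) (hx : powX 1 ∈ B) (hy : powY 1 ∈ B) {p q : Heisenberg} (hp : p ∈ A)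
    (hq : q ∈ A) (hpq : stdGraph.Adj p q) :
    (mulCayley S).LinkedIn (thicken k B A : Set Heisenberg) (dilate k p) (dilate k q) := by
  have key : ∀ p q, p ∈ A → q ∈ A → q = p * powX 1 ∨ q = p * powY 1 →
      (mulCayley S).LinkedIn (thicken k B A : Set Heisenberg) (dilate k p) (dilate k q) := by
    rintro p q hp hq (rfl | rfl)
    · convert linkedIn_dilate_mul_powX hB hx hp hq le_rfl h1 using 1
      ext <;> simp [dilate, powX]
      ring
    · convert linkedIn_dilate_mul_powY hB hy hp hq le_rfl h1 using 1
      ext <;> simp [dilate, powY] <;> ring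
  rcases stdGraph_adj.1 hpq with h | h
  · exact key p q hp hq h
  · exact (key q p hq hp h).symm

/-- Thickening a connected set with more than one element gives a connected set. -/
theorem linkedIn_thicken (hB : ∀ c ∈ B, (mulCayley S).LinkedIn (B : Set Heisenberg) 1 c)
    (h1 : 1 ∈ B) (hx : powX 1 ∈ B) (hy : powY 1 ∈ B)
    (hA : ∀ p ∈ A, ∀ q ∈ A, stdGraph.LinkedIn (A : Set Heisenberg) p q)
    {g h : Heisenberg} (hg : g ∈ thicken k B A) (hh : h ∈ thicken k B A) :
    (mulCayley S).LinkedIn (thicken k B A : Set Heisenberg) g h := by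
  have hnear : ∀ g ∈ thicken k B A, ∃ p ∈ A,
      (mulCayley S).LinkedIn (thicken k B A : Set Heisenberg) (dilate k p) g := by
    intro g hg
    obtain ⟨p, hp, i, hi, s, hs, ⟨hp', rfl⟩ | ⟨hp', rfl⟩⟩ := mem_thicken.1 hg
    · exact ⟨p, hp, linkedIn_dilate_mul_powX hB hx hp hp' hi hs⟩
    · exact ⟨p, hp, linkedIn_dilate_mul_powY hB hy hp hp' hi hs⟩
  obtain ⟨p, hp, hpg⟩ := hnear g hg
  obtain ⟨q, hq, hqh⟩ := hnear h hh
  refine hpg.symm.trans (.trans ?_ hqh)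
  exact (hA p hp q hq).induction_on
    (P := fun u => (mulCayley S).LinkedIn (thicken k B A : Set Heisenberg) (dilate k u)
      (dilate k q)) (.refl hqh.source_mem)
    fun u v hu hv huv ih => (linkedIn_thicken_of_adj hB h1 hx hy hu hv huv).trans ih

end Linked

/-! ### Dilated edges that come close share an end -/

section Disjoint

variable {r : ℤ} {K : ℤ} {p q : Heisenberg} {i j : ℤ}

/-- Off the direction of the segments, the coordinates differ by multiples of `K` and `K ^ 2`, so
closeness forces equality. Along the direction, two segments of length `K` at distance below `K`
have starting points fewer than two steps apart. -/
theorem eq_or_of_near_powX_powX (hK : 2 * r < K) (hi : 0 ≤ i) (hi' : i ≤ K) (hj : 0 ≤ j)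
    (hj' : j ≤ K) (ha : |((dilate K p * powX i)⁻¹ * (dilate K q * powX j)).a| ≤ r)
    (hb : |((dilate K p * powX i)⁻¹ * (dilate K q * powX j)).b| ≤ r)
    (hc : |((dilate K p * powX i)⁻¹ * (dilate K q * powX j)).c| ≤ r) :
    q = p ∨ q = p * powX 1 ∨ p = q * powX 1 := by
  have hr : 0 ≤ r := (abs_nonneg _).trans ha
  simp only [dilate, powX, mul_a, mul_b, mul_c, inv_a, inv_b, inv_c] at ha hb hc
  have hbz : q.b - p.b = 0 := by
    refine Int.eq_zero_of_abs_mul_lt (k := K) (lt_of_le_of_lt (le_of_eq_of_le ?_ hb) (by linarith))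
    ring_nf
  have hbe : q.b = p.b := by linarith
  have hcz : q.c - p.c = 0 := by
    refine Int.eq_zero_of_abs_mul_lt (k := K ^ 2)
      (lt_of_le_of_lt (le_of_eq_of_le ?_ hc) (by nlinarith))
    rw [hbe]
    ring_nf
  rw [abs_le] at ha
  have h1 : q.a - p.a < 2 := by nlinarith
  have h2 : -2 < q.a - p.a := by nlinarith
  have h3 : q.a = p.a ∨ q.a = p.a + 1 ∨ p.a = q.a + 1 := by omega
  rcases h3 with h3 | h3 | h3
  · exact .inl (Heisenberg.ext h3 hbe (by linarith))
  · refine .inr (.inl (Heisenberg.ext ?_ ?_ ?_)) <;> simp [powX] <;> linarith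
  · refine .inr (.inr (Heisenberg.ext ?_ ?_ ?_)) <;> simp [powX] <;> linarith

/-- As for two segments of the first direction, except that the height is compared after subtracting
the shear `p.a * (q.b - p.b)` accumulated along the second generator. -/
theorem eq_or_of_near_powY_powY (hK : 2 * r < K) (hi : 0 ≤ i) (hi' : i ≤ K) (hj : 0 ≤ j)
    (hj' : j ≤ K) (ha : |((dilate K p * powY i)⁻¹ * (dilate K q * powY j)).a| ≤ r)
    (hb : |((dilate K p * powY i)⁻¹ * (dilate K q * powY j)).b| ≤ r)
    (hc : |((dilate K p * powY i)⁻¹ * (dilate K q * powY j)).c| ≤ r) :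
    q = p ∨ q = p * powY 1 ∨ p = q * powY 1 := by
  have hr : 0 ≤ r := (abs_nonneg _).trans ha
  simp only [dilate, powY, mul_a, mul_b, mul_c, inv_a, inv_b, inv_c] at ha hb hc
  have haz : q.a - p.a = 0 := by
    refine Int.eq_zero_of_abs_mul_lt (k := K) (lt_of_le_of_lt (le_of_eq_of_le ?_ ha) (by linarith))
    ring_nf
  have hae : q.a = p.a := by linarith
  have hcz : q.c - p.c - p.a * (q.b - p.b) = 0 := by
    refine Int.eq_zero_of_abs_mul_lt (k := K ^ 2)
      (lt_of_le_of_lt (le_of_eq_of_le ?_ hc) (by nlinarith))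
    rw [hae]
    ring_nf
  rw [abs_le] at hb
  have h1 : q.b - p.b < 2 := by nlinarith
  have h2 : -2 < q.b - p.b := by nlinarith
  have h3 : q.b - p.b = 0 ∨ q.b - p.b = 1 ∨ q.b - p.b = -1 := by omega
  rcases h3 with h3 | h3 | h3 <;> rw [h3] at hcz
  · exact .inl (Heisenberg.ext hae (by linarith) (by linarith))
  · refine .inr (.inl (Heisenberg.ext ?_ ?_ ?_)) <;> simp [powY] <;> linarith
  · refine .inr (.inr (Heisenberg.ext ?_ ?_ ?_)) <;> simp [powY] <;> linarith

/-- For segments of different directions, the height difference is a multiple of `K ^ 2` up to the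
product of the two horizontal errors. This is the reason for the condition `r ^ 2 + r < K ^ 2`. The
remaining four combinations are the four ways to share an end. -/
theorem eq_or_of_near_powX_powY (hK : 2 * r < K) (hr2 : r ^ 2 + r < K ^ 2) (hi : 0 ≤ i)
    (hi' : i ≤ K) (hj : 0 ≤ j) (hj' : j ≤ K)
    (ha : |((dilate K p * powX i)⁻¹ * (dilate K q * powY j)).a| ≤ r)
    (hb : |((dilate K p * powX i)⁻¹ * (dilate K q * powY j)).b| ≤ r)
    (hc : |((dilate K p * powX i)⁻¹ * (dilate K q * powY j)).c| ≤ r) :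
    (p = q ∨ p = q * powY 1) ∨ p * powX 1 = q ∨ p * powX 1 = q * powY 1 := by
  have hr : 0 ≤ r := (abs_nonneg _).trans ha
  simp only [dilate, powX, powY, mul_a, mul_b, mul_c, inv_a, inv_b, inv_c] at ha hb hc
  have ha' : |K * (q.a - p.a) - i| ≤ r := le_of_eq_of_le (by ring_nf) ha
  have hb' : |K * (q.b - p.b) + j| ≤ r := le_of_eq_of_le (by ring_nf) hb
  have hcz : q.c - p.c - q.a * (q.b - p.b) = 0 := by
    refine Int.eq_zero_of_abs_mul_lt (k := K ^ 2) ?_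
    have h1 : K ^ 2 * (q.c - p.c - q.a * (q.b - p.b))
        = (-(K * p.a + i) * (K * q.b + j - K * p.b) + (K ^ 2 * q.c + K * q.a * j) - K ^ 2 * p.c)
          - (K * (q.b - p.b) + j) * (K * (q.a - p.a) - i) := by ring
    have h2 : |(-(K * p.a + i) * (K * q.b + j - K * p.b) + (K ^ 2 * q.c + K * q.a * j)
        - K ^ 2 * p.c)| ≤ r := le_of_eq_of_le (by ring_nf) hc
    have h3 : |(K * (q.b - p.b) + j) * (K * (q.a - p.a) - i)| ≤ r * r := by
      rw [abs_mul]; exact mul_le_mul hb' ha' (abs_nonneg _) hr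
    rw [h1]
    refine (abs_sub _ _).trans_lt ?_
    nlinarith
  rw [abs_le] at ha' hb'
  have a1 : q.a - p.a < 2 := by nlinarith
  have a2 : -1 < q.a - p.a := by nlinarith
  have b1 : q.b - p.b < 1 := by nlinarith
  have b2 : -2 < q.b - p.b := by nlinarith
  have a3 : q.a - p.a = 0 ∨ q.a - p.a = 1 := by omega
  have b3 : q.b - p.b = 0 ∨ q.b - p.b = -1 := by omega
  rcases b3 with b3 | b3 <;> rw [b3] at hcz <;> rcases a3 with a3 | a3
  · refine .inl (.inl (Heisenberg.ext ?_ ?_ ?_)) <;> linarith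
  · refine .inr (.inl (Heisenberg.ext ?_ ?_ ?_)) <;> simp [powX] <;> linarith
  · refine .inl (.inr (Heisenberg.ext ?_ ?_ ?_)) <;> simp [powY] <;> linarith
  · refine .inr (.inr (Heisenberg.ext ?_ ?_ ?_)) <;> simp [powX, powY] <;> linarith

end Disjoint

/-- For a large dilation factor, thickening preserves disjointness. -/
theorem exists_disjoint_thicken (B : Finset Heisenberg) : ∃ k : ℕ, 0 < k ∧
    ∀ A A' : Finset Heisenberg, Disjoint A A' → Disjoint (thicken k B A) (thicken k B A') := by
  obtain ⟨r, hr⟩ : ∃ r : ℕ, ∀ s ∈ B, ∀ t ∈ B, |(s * t⁻¹).a| ≤ r ∧ |(s * t⁻¹).b| ≤ r ∧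
      |(s * t⁻¹).c| ≤ r := by
    set f : Heisenberg × Heisenberg → ℕ := fun t =>
      (t.1 * t.2⁻¹).a.natAbs + (t.1 * t.2⁻¹).b.natAbs + (t.1 * t.2⁻¹).c.natAbs with hf
    refine ⟨(B ×ˢ B).sup f, fun s hs t ht => ?_⟩
    have h := Finset.le_sup (f := f) (Finset.mk_mem_product hs ht)
    simp only [hf] at h
    simp only [hf, Int.abs_eq_natAbs]
    refine ⟨?_, ?_, ?_⟩ <;> norm_cast <;> omega
  -- If translates of `B` at two points meet, the points differ by a quotient of elements of `B`,
  -- whose coordinates are bounded by `r`. The factor `2 * r + 2` exceeds all such errors.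
  refine ⟨2 * r + 2, by omega, fun A A' hAA => Finset.disjoint_left.2 fun g hg hg' => ?_⟩
  have hK : 2 * (r : ℤ) < ((2 * r + 2 : ℕ) : ℤ) := by push_cast; linarith
  have hr2 : (r : ℤ) ^ 2 + r < ((2 * r + 2 : ℕ) : ℤ) ^ 2 := by push_cast; nlinarith
  have hne : ∀ x, x ∈ A → x ∈ A' → False := fun x hx hx' => Finset.disjoint_left.1 hAA hx hx'
  have hnear : ∀ u v s t : Heisenberg, s ∈ B → t ∈ B → u * s = v * t →
      |(u⁻¹ * v).a| ≤ r ∧ |(u⁻¹ * v).b| ≤ r ∧ |(u⁻¹ * v).c| ≤ r := by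
    intro u v s t hs ht h
    have : u⁻¹ * v = s * t⁻¹ := by
      rw [inv_mul_eq_iff_eq_mul, ← mul_assoc, h, mul_inv_cancel_right]
    rw [this]
    exact hr s hs t ht
  have hcast : ∀ i : ℕ, i ≤ 2 * r + 2 → (i : ℤ) ≤ ((2 * r + 2 : ℕ) : ℤ) := fun i hi => by
    exact_mod_cast hi
  obtain ⟨p, hp, i, hi, s, hs, ⟨hp', h⟩ | ⟨hp', h⟩⟩ := mem_thicken.1 hg <;>
  obtain ⟨q, hq, j, hj, t, ht, ⟨hq', h'⟩ | ⟨hq', h'⟩⟩ := mem_thicken.1 hg'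
  · obtain ⟨ha, hb, hc⟩ := hnear _ _ s t hs ht (h.symm.trans h')
    rcases eq_or_of_near_powX_powX hK (by positivity) (hcast i hi) (by positivity) (hcast j hj)
      ha hb hc with e | e | e
    · exact hne q (e ▸ hp) hq
    · exact hne q (e ▸ hp') hq
    · exact hne p hp (e ▸ hq')
  · obtain ⟨ha, hb, hc⟩ := hnear _ _ s t hs ht (h.symm.trans h')
    rcases eq_or_of_near_powX_powY hK hr2 (by positivity) (hcast i hi) (by positivity) (hcast j hj)
      ha hb hc with (e | e) | e | e
    · exact hne q (e ▸ hp) hq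
    · exact hne p hp (e ▸ hq')
    · exact hne q (e ▸ hp') hq
    · exact hne _ hp' (e ▸ hq')
  · obtain ⟨ha, hb, hc⟩ := hnear _ _ t s ht hs (h'.symm.trans h)
    rcases eq_or_of_near_powX_powY hK hr2 (by positivity) (hcast j hj) (by positivity) (hcast i hi)
      ha hb hc with (e | e) | e | e
    · exact hne q (e ▸ hp) hq
    · exact hne q (e ▸ hp') hq
    · exact hne p hp (e ▸ hq')
    · exact hne _ hp' (e ▸ hq')
  · obtain ⟨ha, hb, hc⟩ := hnear _ _ s t hs ht (h.symm.trans h')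
    rcases eq_or_of_near_powY_powY hK (by positivity) (hcast i hi) (by positivity) (hcast j hj)
      ha hb hc with e | e | e
    · exact hne q (e ▸ hp) hq
    · exact hne q (e ▸ hp') hq
    · exact hne p hp (e ▸ hq')

end Heisenberg

/-! ### Networks of lines in the standard Cayley graph -/

namespace Heisenberg

open SimpleGraph

variable {R : ℤ} {M K χ : ℕ}

/-- The line in direction of the first generator over the point `p` of the `(b, c)`-plane. -/
noncomputable def xLine (R : ℤ) (M χ : ℕ) (p : ℤ × ℤ) : Finset Heisenberg :=
  (Finset.Icc (0 : ℤ) M).image fun a => ⟨a, R * p.1, R ^ 2 * p.2 + 2 * χ⟩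

/-- The line in direction of the second generator that runs in the layer `q.1` and has the
equation `c = q.2 + q.1 * b`. -/
noncomputable def yLine (R : ℤ) (M χ : ℕ) (q : ℤ × ℤ) : Finset Heisenberg :=
  (Finset.Icc (0 : ℤ) M).image fun b => ⟨R * q.1, b, R ^ 2 * q.2 + 2 * χ + 1 + R * q.1 * b⟩

/-- The vertex that connects the lines `xLine p` and `yLine q`. -/
def corner (R : ℤ) (χ : ℕ) (p q : ℤ × ℤ) : Heisenberg :=
  ⟨R * q.1 + 1, R * p.1 + 1, R ^ 2 * p.2 + 2 * χ + 1 + R * q.1⟩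

/-- A set of vertices that connects the levels of all colours at the point `p`. -/
noncomputable def ladder (R : ℤ) (K : ℕ) (p : ℤ × ℤ) : Finset Heisenberg :=
  (({-1, 0} : Finset ℤ) ×ˢ ({R * p.1, R * p.1 + 1} : Finset ℤ) ×ˢ
    Finset.Icc (R ^ 2 * p.2) (R ^ 2 * p.2 + 2 * K)).image fun t => ⟨t.1, t.2.1, t.2.2⟩

/-- The union of the lines `X` and `Y`, with corners at all crossings, and of the ladders `L`. -/
noncomputable def network (R : ℤ) (M K χ : ℕ) (X Y L : Finset (ℤ × ℤ)) : Finset Heisenberg :=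
  (L.biUnion (ladder R K) ∪ X.biUnion (xLine R M χ)) ∪ (Y.biUnion (yLine R M χ) ∪
    ((X ×ˢ Y).filter fun t => t.1.2 = t.2.2 + t.2.1 * t.1.1).image fun t => corner R χ t.1 t.2)

theorem mem_xLine {p : ℤ × ℤ} {g : Heisenberg} : g ∈ xLine R M χ p ↔
    (0 ≤ g.a ∧ g.a ≤ M) ∧ g.b = R * p.1 ∧ g.c = R ^ 2 * p.2 + 2 * χ := by
  simp only [xLine, Finset.mem_image, Finset.mem_Icc]
  constructor
  · rintro ⟨a, ha, rfl⟩; exact ⟨ha, rfl, rfl⟩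
  · rintro ⟨h1, h2, h3⟩; exact ⟨g.a, h1, Heisenberg.ext rfl h2.symm h3.symm⟩

theorem mem_yLine {q : ℤ × ℤ} {g : Heisenberg} : g ∈ yLine R M χ q ↔
    (0 ≤ g.b ∧ g.b ≤ M) ∧ g.a = R * q.1 ∧ g.c = R ^ 2 * q.2 + 2 * χ + 1 + R * q.1 * g.b := by
  simp only [yLine, Finset.mem_image, Finset.mem_Icc]
  constructor
  · rintro ⟨b, hb, rfl⟩; exact ⟨hb, rfl, rfl⟩
  · rintro ⟨h1, h2, h3⟩; exact ⟨g.b, h1, Heisenberg.ext h2.symm rfl h3.symm⟩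

theorem mem_ladder {p : ℤ × ℤ} {g : Heisenberg} : g ∈ ladder R K p ↔
    (g.a = -1 ∨ g.a = 0) ∧ (g.b = R * p.1 ∨ g.b = R * p.1 + 1) ∧
      R ^ 2 * p.2 ≤ g.c ∧ g.c ≤ R ^ 2 * p.2 + 2 * K := by
  simp only [ladder, Finset.mem_image, Finset.mem_product, Finset.mem_insert,
    Finset.mem_singleton, Finset.mem_Icc, Prod.exists]
  constructor
  · rintro ⟨a, b, c, h, rfl⟩; exact h
  · intro h; exact ⟨g.a, g.b, g.c, h, rfl⟩

theorem mem_network {X Y L : Finset (ℤ × ℤ)} {g : Heisenberg} : g ∈ network R M K χ X Y L ↔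
    ((∃ p ∈ L, g ∈ ladder R K p) ∨ ∃ p ∈ X, g ∈ xLine R M χ p) ∨
    (∃ q ∈ Y, g ∈ yLine R M χ q) ∨
      ∃ p ∈ X, ∃ q ∈ Y, p.2 = q.2 + q.1 * p.1 ∧ g = corner R χ p q := by
  simp only [network, Finset.mem_union, Finset.mem_biUnion, Finset.mem_image, Finset.mem_filter,
    Finset.mem_product]
  refine or_congr_right (or_congr_right ⟨?_, ?_⟩)
  · rintro ⟨⟨p, q⟩, ⟨⟨hp, hq⟩, h⟩, rfl⟩; exact ⟨p, hp, q, hq, h, rfl⟩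
  · rintro ⟨p, hp, q, hq, h, rfl⟩; exact ⟨(p, q), ⟨⟨hp, hq⟩, h⟩, rfl⟩

theorem card_network_le {X Y L : Finset (ℤ × ℤ)} : (network R M K χ X Y L).card ≤
    L.card * (4 * (2 * K + 1)) + X.card * (M + 1) + (Y.card * (M + 1) + X.card * Y.card) := by
  refine (Finset.card_union_le _ _).trans (add_le_add ((Finset.card_union_le _ _).trans
    (add_le_add ?_ ?_)) ((Finset.card_union_le _ _).trans (add_le_add ?_ ?_)))
  · refine Finset.card_biUnion_le_card_mul _ _ _ fun p _ => Finset.card_image_le.trans ?_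
    rw [Finset.card_product, Finset.card_product, Int.card_Icc, ← mul_assoc]
    refine Nat.mul_le_mul (Nat.mul_le_mul (Finset.card_le_two) Finset.card_le_two) ?_
    omega
  · refine Finset.card_biUnion_le_card_mul _ _ _ fun p _ => Finset.card_image_le.trans ?_
    rw [Int.card_Icc]; omega
  · refine Finset.card_biUnion_le_card_mul _ _ _ fun p _ => Finset.card_image_le.trans ?_
    rw [Int.card_Icc]; omega
  · exact Finset.card_image_le.trans ((Finset.card_filter_le _ _).trans
      (Finset.card_product _ _).le)

/-! #### Disjointness -/

theorem eq_of_mul_add_eq {m c c' i j : ℤ} (hi : 0 ≤ i) (hi' : i < m) (hj : 0 ≤ j) (hj' : j < m)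
    (h : m * c + i = m * c' + j) : c = c' ∧ i = j := by
  have h1 : m * (c - c') = j - i := by linarith
  have h2 : c - c' = 0 := Int.eq_zero_of_abs_mul_lt (k := m) (by
    rw [h1, abs_lt]; constructor <;> linarith)
  have h3 : c = c' := by linarith
  exact ⟨h3, by rw [h3] at h; linarith⟩

/-- Residues separate the pieces. Since `R` is even, lines of the first direction have even height
and those of the second odd height. Corners have `a` and `b` congruent to `1` modulo `R`, which no
line matches in both coordinates. The height modulo `R ^ 2` reveals the colour, so lines of
different colours never meet. Ladders live at `a ≤ 0`, where only lines of the first direction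
starting at the same point can reach them. -/
theorem disjoint_network {χ' : ℕ} {X Y L X' Y' L' : Finset (ℤ × ℤ)} (hR : 1 < R)
    (hev : Even R) (hK : 2 * (K : ℤ) + 1 < R ^ 2) (hχ : χ ≤ K) (hχ' : χ' ≤ K)
    (hY : ∀ q ∈ Y, 1 ≤ q.1) (hY' : ∀ q ∈ Y', 1 ≤ q.1)
    (hXX : χ = χ' → Disjoint X X') (hYY : χ = χ' → Disjoint Y Y') (hLL : Disjoint L L')
    (hLX : Disjoint L X') (hXL : Disjoint X L') :
    Disjoint (network R M K χ X Y L) (network R M K χ' X' Y' L') := by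
  have hR0 : R ≠ 0 := by linarith
  have hχ0 : 2 * (χ : ℤ) + 1 < R ^ 2 := by
    have : (χ : ℤ) ≤ K := by exact_mod_cast hχ
    linarith
  have hχ0' : 2 * (χ' : ℤ) + 1 < R ^ 2 := by
    have : (χ' : ℤ) ≤ K := by exact_mod_cast hχ'
    linarith
  have hmod : ∀ x y : ℤ, R * x ≠ R * y + 1 := by
    intro x y h
    have := eq_of_mul_add_eq (m := R) le_rfl (by linarith) zero_le_one hR
      (show R * x + 0 = R * y + 1 by linarith)
    omega
  -- A ladder stays in a window of heights shorter than `R ^ 2`, so the windows over different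
  -- points are disjoint.
  have hwin : ∀ (c c' i : ℤ), R ^ 2 * c' ≤ R ^ 2 * c + i → R ^ 2 * c + i ≤ R ^ 2 * c' + 2 * K →
      0 ≤ i → i < R ^ 2 → c = c' := by
    intro c c' i h1 h2 hi hi'
    exact (eq_of_mul_add_eq (m := R ^ 2) (j := R ^ 2 * c + i - R ^ 2 * c') hi hi' (by linarith)
      (by linarith) (by ring)).1
  have hlev : ∀ (p p' : ℤ × ℤ), p.1 = p'.1 → R ^ 2 * p.2 + 2 * (χ : ℤ) = R ^ 2 * p'.2 + 2 * χ' →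
      p = p' ∧ χ = χ' := by
    intro p p' hb h
    obtain ⟨h1, h2⟩ := eq_of_mul_add_eq (m := R ^ 2) (by positivity) (by linarith) (by positivity)
      (by linarith) h
    exact ⟨Prod.ext hb h1, by omega⟩
  have key : ∀ {α : Type} {s t : Finset α} {x : α}, Disjoint s t → x ∈ s → x ∈ t → False :=
    fun h hs ht => Finset.disjoint_left.1 h hs ht
  have hneg : ∀ a t : ℤ, 1 ≤ t → (a = -1 ∨ a = 0) → a ≠ R * t ∧ a ≠ R * t + 1 := by
    intro a t ht ha
    have : R * 1 ≤ R * t := mul_le_mul_of_nonneg_left ht (by linarith)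
    constructor <;> rintro rfl <;> rcases ha with h | h <;> linarith
  obtain ⟨ρ, hρ⟩ := hev
  have hpar : ∀ c o t b i j : ℤ,
      R ^ 2 * c + 2 * i ≠ R ^ 2 * o + 2 * j + 1 + R * t * b := by
    intro c o t b i j h
    have h2 : 2 * (ρ * (R * c) + i) = 2 * (ρ * (R * o) + j + ρ * t * b) + 1 := by
      have e : R * t * b = 2 * (ρ * t * b) := by rw [hρ]; ring
      have e1 : ∀ c, R ^ 2 * c = 2 * (ρ * (R * c)) := fun c => by
        rw [pow_two, mul_assoc]; nth_rewrite 1 [hρ]; ring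
      rw [e, e1, e1] at h
      linarith
    omega
  refine Finset.disjoint_left.2 fun g hg hg' => ?_
  rcases mem_network.1 hg with (⟨p, hp, h⟩ | ⟨p, hp, h⟩) | ⟨q, hq, h⟩ |
    ⟨p, hp, q, hq, hpq, h⟩ <;>
  rcases mem_network.1 hg' with (⟨p', hp', h'⟩ | ⟨p', hp', h'⟩) | ⟨q', hq', h'⟩ |
    ⟨p', hp', q', hq', hpq', h'⟩ <;>
  simp only [mem_xLine, mem_yLine, mem_ladder, corner] at h h'
  · obtain ⟨-, hb, hc1, hc2⟩ := h
    obtain ⟨-, hb', hc1', hc2'⟩ := h'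
    have hbb : p.1 = p'.1 := by
      refine mul_left_cancel₀ hR0 ?_
      rcases hb with hb | hb <;> rcases hb' with hb' | hb'
      · exact hb.symm.trans hb'
      · exact absurd (hb.symm.trans hb') (hmod _ _)
      · exact absurd (hb'.symm.trans hb) (hmod _ _)
      · linarith
    have hcc : p.2 = p'.2 := hwin p.2 p'.2 (g.c - R ^ 2 * p.2) (by linarith) (by linarith)
      (by linarith) (by linarith)
    have : p = p' := Prod.ext hbb hcc
    exact key hLL hp (this ▸ hp')
  · obtain ⟨-, hb, hc1, hc2⟩ := h
    obtain ⟨-, hb', hc'⟩ := h'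
    have hbb : p.1 = p'.1 := by
      refine mul_left_cancel₀ hR0 ?_
      rcases hb with hb | hb
      · exact hb.symm.trans hb'
      · exact absurd (hb'.symm.trans hb) (hmod _ _)
    have hcc : p'.2 = p.2 := hwin p'.2 p.2 (2 * χ') (by linarith) (by linarith)
      (by positivity) (by linarith)
    have : p = p' := Prod.ext hbb hcc.symm
    exact key hLX hp (this ▸ hp')
  · exact (hneg _ _ (hY' q' hq') h.1).1 h'.2.1
  · exact (hneg _ _ (hY' q' hq') h.1).2 (congrArg a h')
  · obtain ⟨-, hb, hc⟩ := h
    obtain ⟨-, hb', hc1', hc2'⟩ := h'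
    have hbb : p.1 = p'.1 := by
      refine mul_left_cancel₀ hR0 ?_
      rcases hb' with hb' | hb'
      · exact hb.symm.trans hb'
      · exact absurd (hb.symm.trans hb') (hmod _ _)
    have hcc : p.2 = p'.2 := hwin p.2 p'.2 (2 * χ) (by linarith) (by linarith)
      (by positivity) (by linarith)
    have : p = p' := Prod.ext hbb hcc
    exact key hXL hp (this ▸ hp')
  · obtain ⟨e1, e2⟩ := hlev p p' (mul_left_cancel₀ hR0 (h.2.1.symm.trans h'.2.1))
      (h.2.2.symm.trans h'.2.2)
    exact key (hXX e2) hp (e1 ▸ hp')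
  · exact hpar _ _ _ _ _ _ (h.2.2.symm.trans h'.2.2)
  · exact hmod _ _ (h.2.1.symm.trans (congrArg b h'))
  · exact (hneg _ _ (hY q hq) h'.1).1 h.2.1
  · exact hpar _ _ _ _ _ _ (h'.2.2.symm.trans h.2.2)
  · have ht : q.1 = q'.1 := mul_left_cancel₀ hR0 (h.2.1.symm.trans h'.2.1)
    have h1 : R ^ 2 * q.2 + 2 * (χ : ℤ) = R ^ 2 * q'.2 + 2 * χ' := by
      have := h.2.2.symm.trans h'.2.2
      rw [ht] at this
      linarith
    obtain ⟨e1, e2⟩ := hlev q q' ht h1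
    exact key (hYY e2) hq (e1 ▸ hq')
  · exact hmod _ _ (h.2.1.symm.trans (congrArg a h'))
  · exact (hneg _ _ (hY q hq) h'.1).2 (congrArg a h)
  · exact hmod _ _ (h'.2.1.symm.trans (congrArg b h))
  · exact hmod _ _ (h'.2.1.symm.trans (congrArg a h))
  · injection h.symm.trans h' with ha hb hc
    have ht : R * q.1 = R * q'.1 := by linarith
    obtain ⟨e1, e2⟩ := hlev p p' (mul_left_cancel₀ hR0 (by linarith)) (by linarith)
    exact key (hXX e2) hp (e1 ▸ hp')

/-! #### Connectedness -/

theorem stdGraph_adj_mul_powX (p : Heisenberg) : stdGraph.Adj p (p * powX 1) :=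
  stdGraph_adj.2 (.inl (.inl rfl))

theorem stdGraph_adj_mul_powY (p : Heisenberg) : stdGraph.Adj p (p * powY 1) :=
  stdGraph_adj.2 (.inl (.inr rfl))

section Linked

variable {A : Set Heisenberg}

theorem linkedIn_of_xLine_subset {p : ℤ × ℤ} (h : (xLine R M χ p : Set Heisenberg) ⊆ A)
    {g : Heisenberg} (hg : g ∈ xLine R M χ p) :
    stdGraph.LinkedIn A ⟨0, R * p.1, R ^ 2 * p.2 + 2 * χ⟩ g := by
  have key : ∀ n : ℕ, n ≤ M → stdGraph.LinkedIn A ⟨0, R * p.1, R ^ 2 * p.2 + 2 * χ⟩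
      ⟨n, R * p.1, R ^ 2 * p.2 + 2 * χ⟩ := by
    have hmem : ∀ n : ℕ, n ≤ M → (⟨n, R * p.1, R ^ 2 * p.2 + 2 * χ⟩ : Heisenberg) ∈ A :=
      fun n hn => h (by simpa [mem_xLine] using hn)
    intro n
    induction n with
    | zero => exact fun hn => .refl (hmem 0 hn)
    | succ n ih =>
      intro hn
      refine (ih (by omega)).trans (.of_adj ?_ (hmem n (by omega)) (hmem _ hn))
      convert stdGraph_adj_mul_powX _ using 1
      ext <;> simp [powX]
  obtain ⟨⟨h1, h2⟩, h3, h4⟩ := mem_xLine.1 hg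
  convert key g.a.toNat (by omega) using 1
  ext <;> simp [*]

theorem linkedIn_of_yLine_subset {q : ℤ × ℤ} (h : (yLine R M χ q : Set Heisenberg) ⊆ A)
    {g : Heisenberg} (hg : g ∈ yLine R M χ q) :
    stdGraph.LinkedIn A ⟨R * q.1, 0, R ^ 2 * q.2 + 2 * χ + 1⟩ g := by
  have key : ∀ n : ℕ, n ≤ M → stdGraph.LinkedIn A ⟨R * q.1, 0, R ^ 2 * q.2 + 2 * χ + 1⟩
      ⟨R * q.1, n, R ^ 2 * q.2 + 2 * χ + 1 + R * q.1 * n⟩ := by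
    have hmem : ∀ n : ℕ, n ≤ M →
        (⟨R * q.1, n, R ^ 2 * q.2 + 2 * χ + 1 + R * q.1 * n⟩ : Heisenberg) ∈ A :=
      fun n hn => h (by simpa [mem_yLine] using hn)
    intro n
    induction n with
    | zero =>
      intro hn
      have := hmem 0 hn
      simp only [Nat.cast_zero, mul_zero, add_zero] at this ⊢
      exact .refl this
    | succ n ih =>
      intro hn
      refine (ih (by omega)).trans (.of_adj ?_ (hmem n (by omega)) (hmem _ hn))
      convert stdGraph_adj_mul_powY _ using 1
      ext <;> simp [powY]
      ring
  obtain ⟨⟨h1, h2⟩, h3, h4⟩ := mem_yLine.1 hg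
  convert key g.b.toNat (by omega) using 1
  ext <;> simp [*]

/-- Going once around the commutator square at `a = 0` and `a = -1` raises the height by one. -/
theorem linkedIn_of_ladder_subset {p : ℤ × ℤ} (h : (ladder R K p : Set Heisenberg) ⊆ A)
    {g : Heisenberg} (hg : g ∈ ladder R K p) :
    stdGraph.LinkedIn A ⟨0, R * p.1, R ^ 2 * p.2⟩ g := by
  have hmem : ∀ (a b : ℤ) (n : ℕ), (a = -1 ∨ a = 0) → (b = 0 ∨ b = 1) → n ≤ 2 * K →
      (⟨a, R * p.1 + b, R ^ 2 * p.2 + n⟩ : Heisenberg) ∈ A := by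
    intro a b n ha hb hn
    refine h (mem_ladder.2 ⟨ha, hb.imp ?_ ?_, ?_, ?_⟩)
    · rintro rfl; exact add_zero _
    · rintro rfl; rfl
    · simp
    · simp only; gcongr; exact_mod_cast hn
  have s1 : ∀ n : ℕ, n ≤ 2 * K → stdGraph.LinkedIn A ⟨0, R * p.1 + 0, R ^ 2 * p.2 + n⟩
      ⟨0, R * p.1 + 1, R ^ 2 * p.2 + n⟩ := by
    intro n hn
    refine .of_adj ?_ (hmem _ _ n (.inr rfl) (.inl rfl) hn) (hmem _ _ n (.inr rfl) (.inr rfl) hn)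
    convert stdGraph_adj_mul_powY _ using 1
    ext <;> simp [powY]
  have s2 : ∀ n : ℕ, n ≤ 2 * K → stdGraph.LinkedIn A ⟨0, R * p.1 + 1, R ^ 2 * p.2 + n⟩
      ⟨-1, R * p.1 + 1, R ^ 2 * p.2 + n⟩ := by
    intro n hn
    refine .of_adj (SimpleGraph.Adj.symm ?_) (hmem _ _ n (.inr rfl) (.inr rfl) hn)
      (hmem _ _ n (.inl rfl) (.inr rfl) hn)
    convert stdGraph_adj_mul_powX _ using 1
    ext <;> simp [powX]
  have s3 : ∀ n : ℕ, n ≤ 2 * K → stdGraph.LinkedIn A ⟨-1, R * p.1 + 0, R ^ 2 * p.2 + n⟩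
      ⟨0, R * p.1 + 0, R ^ 2 * p.2 + n⟩ := by
    intro n hn
    refine .of_adj ?_ (hmem _ _ n (.inl rfl) (.inl rfl) hn) (hmem _ _ n (.inr rfl) (.inl rfl) hn)
    convert stdGraph_adj_mul_powX _ using 1
    ext <;> simp [powX]
  -- The height changes on this side only: a backward step of the second generator in the layer `a =
  -- -1` adds `1`.
  have s4 : ∀ n : ℕ, n + 1 ≤ 2 * K → stdGraph.LinkedIn A ⟨-1, R * p.1 + 1, R ^ 2 * p.2 + n⟩
      ⟨-1, R * p.1 + 0, R ^ 2 * p.2 + (n + 1 : ℕ)⟩ := by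
    intro n hn
    refine .of_adj (SimpleGraph.Adj.symm ?_) (hmem _ _ n (.inl rfl) (.inr rfl) (by omega))
      (hmem _ _ (n + 1) (.inl rfl) (.inl rfl) hn)
    convert stdGraph_adj_mul_powY _ using 1
    ext <;> simp [powY]
    ring
  have key : ∀ n : ℕ, n ≤ 2 * K → stdGraph.LinkedIn A ⟨0, R * p.1, R ^ 2 * p.2⟩
      ⟨0, R * p.1 + 0, R ^ 2 * p.2 + n⟩ := by
    intro n
    induction n with
    | zero =>
      intro hn
      have := hmem 0 0 0 (.inr rfl) (.inl rfl) hn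
      simp only [Nat.cast_zero, add_zero] at this ⊢
      exact .refl this
    | succ n ih =>
      intro hn
      exact (ih (by omega)).trans ((s1 n (by omega)).trans ((s2 n (by omega)).trans
        ((s4 n hn).trans (s3 _ hn))))
  obtain ⟨ha, hb, hc1, hc2⟩ := mem_ladder.1 hg
  obtain ⟨n, hn⟩ := Int.eq_ofNat_of_zero_le (sub_nonneg.2 hc1)
  have hn' : n ≤ 2 * K := by omega
  have hge : ∀ a b : ℤ, g.a = a → g.b = R * p.1 + b → g = ⟨a, R * p.1 + b, R ^ 2 * p.2 + n⟩ :=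
    fun a b h1 h2 => Heisenberg.ext h1 h2 (by simp only; linarith)
  refine (key n hn').trans ?_
  rcases ha with ha | ha <;> rcases hb with hb | hb
  · rw [hge (-1) 0 ha (by rw [hb, add_zero])]
    exact (s3 n hn').symm
  · rw [hge (-1) 1 ha hb]
    exact (s1 n hn').trans (s2 n hn')
  · rw [hge 0 0 ha (by rw [hb, add_zero])]
    exact (s1 n hn').trans (s1 n hn').symm
  · rw [hge 0 1 ha hb]
    exact s1 n hn'

end Linked

section Network

variable {X Y L : Finset (ℤ × ℤ)}

theorem xLine_subset_network {p : ℤ × ℤ} (hp : p ∈ X) :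
    (xLine R M χ p : Set Heisenberg) ⊆ network R M K χ X Y L :=
  fun _ hg => mem_network.2 (.inl (.inr ⟨p, hp, hg⟩))

theorem yLine_subset_network {q : ℤ × ℤ} (hq : q ∈ Y) :
    (yLine R M χ q : Set Heisenberg) ⊆ network R M K χ X Y L :=
  fun _ hg => mem_network.2 (.inr (.inl ⟨q, hq, hg⟩))

theorem ladder_subset_network {p : ℤ × ℤ} (hp : p ∈ L) :
    (ladder R K p : Set Heisenberg) ⊆ network R M K χ X Y L :=
  fun _ hg => mem_network.2 (.inl (.inl ⟨p, hp, hg⟩))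

/-- At an incidence the two lines pass at heights of different parity and do not meet. One step of
the second generator from the point of the first line with `a = R * q.1 + 1`, and one step of the
first generator from the point of the second with `b = R * p.1 + 1`, lead to the same vertex. -/
theorem linkedIn_corner {p q : ℤ × ℤ} (hp : p ∈ X) (hq : q ∈ Y) (hpq : p.2 = q.2 + q.1 * p.1)
    (hp0 : 0 ≤ R * p.1) (hpM : R * p.1 + 1 ≤ M) (hq0 : 0 ≤ R * q.1) (hqM : R * q.1 + 1 ≤ M) :
    stdGraph.LinkedIn (network R M K χ X Y L : Set Heisenberg)
        ⟨0, R * p.1, R ^ 2 * p.2 + 2 * χ⟩ (corner R χ p q) ∧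
      stdGraph.LinkedIn (network R M K χ X Y L : Set Heisenberg)
        ⟨R * q.1, 0, R ^ 2 * q.2 + 2 * χ + 1⟩ (corner R χ p q) := by
  have hcor : corner R χ p q ∈ (network R M K χ X Y L : Set Heisenberg) :=
    mem_network.2 (.inr (.inr ⟨p, hp, q, hq, hpq, rfl⟩))
  constructor
  · have hx : (⟨R * q.1 + 1, R * p.1, R ^ 2 * p.2 + 2 * χ⟩ : Heisenberg) ∈ xLine R M χ p :=
      mem_xLine.2 ⟨⟨by simp only; linarith, hqM⟩, rfl, rfl⟩
    refine (linkedIn_of_xLine_subset (xLine_subset_network hp) hx).trans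
      (.of_adj ?_ (xLine_subset_network hp hx) hcor)
    convert stdGraph_adj_mul_powY _ using 1
    ext <;> simp [powY, corner]
    ring
  · have hy : (⟨R * q.1, R * p.1 + 1, R ^ 2 * p.2 + 2 * χ + 1 + R * q.1⟩ : Heisenberg) ∈
        yLine R M χ q :=
      mem_yLine.2 ⟨⟨by simp only; linarith, hpM⟩, rfl, by simp only; rw [hpq]; ring⟩
    refine (linkedIn_of_yLine_subset (yLine_subset_network hq) hy).trans
      (.of_adj ?_ (yLine_subset_network hq hy) hcor)
    convert stdGraph_adj_mul_powX _ using 1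
    ext <;> simp [powX, corner]

/-- A line meeting a ladder is connected to it. -/
theorem linkedIn_ladder_xLine {p : ℤ × ℤ} (hpL : p ∈ L) (hχ : χ ≤ K) :
    stdGraph.LinkedIn (network R M K χ X Y L : Set Heisenberg)
      ⟨0, R * p.1, R ^ 2 * p.2⟩ ⟨0, R * p.1, R ^ 2 * p.2 + 2 * χ⟩ := by
  refine linkedIn_of_ladder_subset (K := K) (ladder_subset_network hpL) (mem_ladder.2
    ⟨.inr rfl, .inl rfl, ?_, ?_⟩)
  · simp
  · simp only; gcongr

/-- If the starting points of all lines and ladders of a network are connected to one vertex,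
then the network is connected. -/
theorem linkedIn_network {o : Heisenberg}
    (hX : ∀ p ∈ X, stdGraph.LinkedIn (network R M K χ X Y L : Set Heisenberg) o
      ⟨0, R * p.1, R ^ 2 * p.2 + 2 * χ⟩)
    (hY : ∀ q ∈ Y, stdGraph.LinkedIn (network R M K χ X Y L : Set Heisenberg) o
      ⟨R * q.1, 0, R ^ 2 * q.2 + 2 * χ + 1⟩)
    (hL : ∀ p ∈ L, stdGraph.LinkedIn (network R M K χ X Y L : Set Heisenberg) o
      ⟨0, R * p.1, R ^ 2 * p.2⟩)
    (hXM : ∀ p ∈ X, 0 ≤ R * p.1 ∧ R * p.1 + 1 ≤ M) (hYM : ∀ q ∈ Y, 0 ≤ R * q.1 ∧ R * q.1 + 1 ≤ M)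
    {g : Heisenberg} (hg : g ∈ network R M K χ X Y L) :
    stdGraph.LinkedIn (network R M K χ X Y L : Set Heisenberg) o g := by
  rcases mem_network.1 hg with (⟨p, hp, h⟩ | ⟨p, hp, h⟩) | ⟨q, hq, h⟩ | ⟨p, hp, q, hq, hpq, rfl⟩
  · exact (hL p hp).trans (linkedIn_of_ladder_subset (ladder_subset_network hp) h)
  · exact (hX p hp).trans (linkedIn_of_xLine_subset (xLine_subset_network hp) h)
  · exact (hY q hq).trans (linkedIn_of_yLine_subset (yLine_subset_network hq) h)
  · exact (hX p hp).trans (linkedIn_corner hp hq hpq (hXM p hp).1 (hXM p hp).2 (hYM q hq).1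
      (hYM q hq).2).1

end Network

end Heisenberg

/-! ### Routing -/

namespace Heisenberg

open SimpleGraph

/-- The slope of the first line of a route from `s` to the meeting point `(w.1, w.2.1)`. -/
def slope (s : ℤ × ℤ) (w : ℤ × ℤ × ℤ) : ℤ := (w.2.1 - s.2) / (w.1 - s.1)

/-- The defect of height after the first line of a route. -/
def defect (s : ℤ × ℤ) (w : ℤ × ℤ × ℤ) : ℤ := (w.2.1 - s.2) % (w.1 - s.1)

/-- The lines in direction of the first generator on the route from `s` to the meeting point. -/
def routeX (s : ℤ × ℤ) (w : ℤ × ℤ × ℤ) : Finset (ℤ × ℤ) :=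
  {(w.1, w.2.1 - defect s w), (w.1 + defect s w, w.2.1 + w.2.2 * defect s w), (w.1, w.2.1)}

/-- The lines in direction of the second generator on the route from `s` to the meeting point. -/
def routeY (s : ℤ × ℤ) (w : ℤ × ℤ × ℤ) : Finset (ℤ × ℤ) :=
  {(slope s w, s.2 - slope s w * s.1),
    (w.2.2 + 1, w.2.1 - defect s w - (w.2.2 + 1) * w.1), (w.2.2, w.2.1 - w.2.2 * w.1)}

/-- All lines on the route from `s` to the meeting point. -/
def route (s : ℤ × ℤ) (w : ℤ × ℤ × ℤ) : Finset ((ℤ × ℤ) ⊕ (ℤ × ℤ)) :=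
  (routeX s w).disjSum (routeY s w)

/-- The starting points of routes. -/
noncomputable def starts (N : ℕ) : Finset (ℤ × ℤ) := Finset.Ico (0 : ℤ) N ×ˢ Finset.Ico (0 : ℤ) (N ^ 2)

/-- The choices for a route: a meeting point and a slope. -/
noncomputable def options (N : ℕ) : Finset (ℤ × ℤ × ℤ) :=
  Finset.Ico (2 * N : ℤ) (3 * N) ×ˢ Finset.Ico (4 * N ^ 2 : ℤ) (5 * N ^ 2) ×ˢ Finset.Icc (1 : ℤ) N

variable {N : ℕ} {s : ℤ × ℤ} {w : ℤ × ℤ × ℤ}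

theorem mem_starts : s ∈ starts N ↔ (0 ≤ s.1 ∧ s.1 < N) ∧ 0 ≤ s.2 ∧ s.2 < N ^ 2 := by
  simp [starts]

theorem mem_options : w ∈ options N ↔ (2 * (N : ℤ) ≤ w.1 ∧ w.1 < 3 * N) ∧
    (4 * (N : ℤ) ^ 2 ≤ w.2.1 ∧ w.2.1 < 5 * N ^ 2) ∧ 1 ≤ w.2.2 ∧ w.2.2 ≤ N := by
  simp [options]

theorem card_options : (options N).card = N ^ 4 := by
  rw [options, Finset.card_product, Finset.card_product, Int.card_Ico, Int.card_Ico, Int.card_Icc]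
  have h1 : (3 * (N : ℤ) - 2 * N).toNat = N := by omega
  have h2 : (5 * (N : ℤ) ^ 2 - 4 * N ^ 2).toNat = N ^ 2 := by
    rw [show (5 * (N : ℤ) ^ 2 - 4 * N ^ 2) = ((N ^ 2 : ℕ) : ℤ) by push_cast; ring]
    exact Int.toNat_natCast _
  have h3 : ((N : ℤ) + 1 - 1).toNat = N := by omega
  rw [h1, h2, h3]; ring

/-- A line of integer slope from `s` arrives over the meeting point too low by the defect `δ`. A
triangle repairs this: `δ` steps forward with slope `w.2.2 + 1` and `δ` steps back with slope
`w.2.2` gain exactly `δ`. -/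
theorem mul_slope_add_defect : (w.1 - s.1) * slope s w + defect s w = w.2.1 - s.2 :=
  Int.mul_ediv_add_emod _ _

/-- The meeting points are placed so that the horizontal distance to a start lies between `N` and `3
* N` and the rise between `3 * N ^ 2` and `5 * N ^ 2`. Positive slopes keep the second-direction
lines away from the ladders. -/
theorem slope_defect_bounds (hs : s ∈ starts N) (hw : w ∈ options N) :
    (1 ≤ slope s w ∧ slope s w ≤ 5 * N) ∧ 0 ≤ defect s w ∧ defect s w < 3 * N := by
  obtain ⟨⟨s1, s2⟩, s3, s4⟩ := mem_starts.1 hs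
  obtain ⟨⟨w1, w2⟩, ⟨w3, w4⟩, w5, w6⟩ := mem_options.1 hw
  have hN : 1 ≤ (N : ℤ) := by linarith
  have hpos : (N : ℤ) < w.1 - s.1 := by linarith
  have d0 : 0 ≤ defect s w := Int.emod_nonneg _ (by linarith)
  have d1 : defect s w < w.1 - s.1 := Int.emod_lt_of_pos _ (by linarith)
  refine ⟨⟨?_, ?_⟩, d0, by linarith⟩
  · rw [slope, Int.le_ediv_iff_mul_le (by linarith)]
    nlinarith
  · refine Int.lt_add_one_iff.1 ?_
    rw [slope, Int.ediv_lt_iff_lt_mul (by linarith)]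
    nlinarith

/-- The lower bound keeps the intermediate points away from all starting points; the upper bound
fixes how long the lines must be. -/
theorem fst_bounds_of_mem_routeX (hs : s ∈ starts N) (hw : w ∈ options N) {p : ℤ × ℤ}
    (hp : p ∈ routeX s w) : 2 * (N : ℤ) ≤ p.1 ∧ p.1 < 6 * N := by
  obtain ⟨⟨w1, w2⟩, -⟩ := mem_options.1 hw
  obtain ⟨-, d0, d1⟩ := slope_defect_bounds hs hw
  simp only [routeX, Finset.mem_insert, Finset.mem_singleton] at hp
  rcases hp with rfl | rfl | rfl <;> constructor <;> simp only <;> linarith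

theorem fst_bounds_of_mem_routeY (hs : s ∈ starts N) (hw : w ∈ options N) {q : ℤ × ℤ}
    (hq : q ∈ routeY s w) : 1 ≤ q.1 ∧ q.1 < 6 * N := by
  obtain ⟨⟨w1, w2⟩, -, w5, w6⟩ := mem_options.1 hw
  obtain ⟨⟨t0, t1⟩, -⟩ := slope_defect_bounds hs hw
  simp only [routeY, Finset.mem_insert, Finset.mem_singleton] at hq
  rcases hq with rfl | rfl | rfl <;> constructor <;> simp only <;> linarith

/-! #### The network of a route -/

/-- The network formed by the routes from the points of `P` to a common meeting point. -/
noncomputable def routeNetwork (R : ℤ) (M K χ : ℕ) (w : ℤ × ℤ × ℤ) (P : Finset (ℤ × ℤ)) :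
    Finset Heisenberg :=
  network R M K χ (P ∪ P.biUnion (routeX · w)) (P.biUnion (routeY · w)) P

section RouteNetwork

variable {R : ℤ} {M K χ : ℕ} {P : Finset (ℤ × ℤ)}

theorem card_routeNetwork_le (hP : P.card ≤ 2) :
    (routeNetwork R M K χ w P).card ≤ 16 * K + 14 * M + 70 := by
  have hX : (P ∪ P.biUnion (routeX · w)).card ≤ 8 := by
    have h1 : (P.biUnion (routeX · w)).card ≤ P.card * 3 :=
      Finset.card_biUnion_le_card_mul _ _ _ fun s _ => Finset.card_le_three
    have h2 := Finset.card_union_le P (P.biUnion (routeX · w))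
    omega
  have hY : (P.biUnion (routeY · w)).card ≤ 6 := by
    have h1 : (P.biUnion (routeY · w)).card ≤ P.card * 3 :=
      Finset.card_biUnion_le_card_mul _ _ _ fun s _ => Finset.card_le_three
    omega
  refine card_network_le.trans ?_
  have h1 := Nat.mul_le_mul_right (4 * (2 * K + 1)) hP
  have h2 := Nat.mul_le_mul_right (M + 1) hX
  have h3 := Nat.mul_le_mul_right (M + 1) hY
  have h4 := Nat.mul_le_mul hX hY
  linarith

theorem linkedIn_routeNetwork (hR : 1 < R) (hM : 6 * N * R ≤ M) (hχ : χ ≤ K)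
    (hP : P ⊆ starts N) (hw : w ∈ options N) {g h : Heisenberg}
    (hg : g ∈ routeNetwork R M K χ w P) (hh : h ∈ routeNetwork R M K χ w P) :
    stdGraph.LinkedIn (routeNetwork R M K χ w P : Set Heisenberg) g h := by
  have hbound : ∀ x : ℤ, 0 ≤ x → x < 6 * N → 0 ≤ R * x ∧ R * x + 1 ≤ M := by
    intro x h0 h1
    have h2 : x ≤ 6 * N - 1 := by linarith
    refine ⟨by positivity, ?_⟩
    nlinarith
  have hN : (0 : ℤ) ≤ N := by positivity
  have hXM : ∀ p ∈ P ∪ P.biUnion (routeX · w), 0 ≤ R * p.1 ∧ R * p.1 + 1 ≤ M := by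
    intro p hp
    rcases Finset.mem_union.1 hp with hp | hp
    · obtain ⟨⟨h1, h2⟩, -⟩ := mem_starts.1 (hP hp)
      exact hbound _ h1 (by linarith)
    · obtain ⟨s, hs, hp⟩ := Finset.mem_biUnion.1 hp
      obtain ⟨h1, h2⟩ := fst_bounds_of_mem_routeX (hP hs) hw hp
      exact hbound _ (by linarith) h2
  have hYM : ∀ q ∈ P.biUnion (routeY · w), 0 ≤ R * q.1 ∧ R * q.1 + 1 ≤ M := by
    intro q hq
    obtain ⟨s, hs, hq⟩ := Finset.mem_biUnion.1 hq
    obtain ⟨h1, h2⟩ := fst_bounds_of_mem_routeY (hP hs) hw hq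
    exact hbound _ (by linarith) h2
  have hcorner : ∀ p ∈ P ∪ P.biUnion (routeX · w), ∀ q ∈ P.biUnion (routeY · w),
      p.2 = q.2 + q.1 * p.1 → stdGraph.LinkedIn (routeNetwork R M K χ w P : Set Heisenberg)
        ⟨0, R * p.1, R ^ 2 * p.2 + 2 * χ⟩ ⟨R * q.1, 0, R ^ 2 * q.2 + 2 * χ + 1⟩ := by
    intro p hp q hq hpq
    obtain ⟨h1, h2⟩ := linkedIn_corner (K := K) (χ := χ) (L := P) hp hq hpq (hXM p hp).1 (hXM p hp).2
      (hYM q hq).1 (hYM q hq).2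
    exact h1.trans h2.symm
  have hmemX : ∀ s ∈ P, ∀ p ∈ routeX s w, p ∈ P ∪ P.biUnion (routeX · w) := fun s hs p hp =>
    Finset.mem_union_right _ (Finset.mem_biUnion.2 ⟨s, hs, hp⟩)
  have hmemY : ∀ s ∈ P, ∀ q ∈ routeY s w, q ∈ P.biUnion (routeY · w) := fun s hs q hq =>
    Finset.mem_biUnion.2 ⟨s, hs, hq⟩
  set o : Heisenberg := ⟨0, R * w.1, R ^ 2 * w.2.1 + 2 * χ⟩ with ho
  have hall : ∀ s ∈ P,
      (∀ p ∈ insert s (routeX s w), stdGraph.LinkedIn (routeNetwork R M K χ w P : Set Heisenberg) o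
        ⟨0, R * p.1, R ^ 2 * p.2 + 2 * χ⟩) ∧
      ∀ q ∈ routeY s w, stdGraph.LinkedIn (routeNetwork R M K χ w P : Set Heisenberg) o
        ⟨R * q.1, 0, R ^ 2 * q.2 + 2 * χ + 1⟩ := by
    intro s hs
    have hsd := mul_slope_add_defect (s := s) (w := w)
    have x0 : s ∈ P ∪ P.biUnion (routeX · w) := Finset.mem_union_left _ hs
    have x1 := hmemX s hs (w.1, w.2.1 - defect s w) (by simp [routeX])
    have x2 := hmemX s hs (w.1 + defect s w, w.2.1 + w.2.2 * defect s w) (by simp [routeX])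
    have x3 := hmemX s hs (w.1, w.2.1) (by simp [routeX])
    have y1 := hmemY s hs (slope s w, s.2 - slope s w * s.1) (by simp [routeY])
    have y2 := hmemY s hs (w.2.2 + 1, w.2.1 - defect s w - (w.2.2 + 1) * w.1) (by simp [routeY])
    have y3 := hmemY s hs (w.2.2, w.2.1 - w.2.2 * w.1) (by simp [routeY])
    -- The route is followed backwards from the meeting point, alternating points and lines: over
    -- the side of slope `w.2.2`, the side of slope `w.2.2 + 1`, and the long line down to `s`.
    have l3 := hcorner _ x3 _ y3 (by simp)
    have l4 := l3.trans (hcorner _ x2 _ y3 (by simp only; ring)).symm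
    have l5 := l4.trans (hcorner _ x2 _ y2 (by simp only; ring))
    have l6 := l5.trans (hcorner _ x1 _ y2 (by simp only; ring)).symm
    have l7 := l6.trans (hcorner _ x1 _ y1 (by simp only; linarith))
    have l8 := l7.trans (hcorner _ x0 _ y1 (by simp)).symm
    constructor
    · intro p hp
      simp only [routeX, Finset.mem_insert, Finset.mem_singleton] at hp
      rcases hp with rfl | rfl | rfl | rfl
      exacts [l8, l6, l4, l3.trans l3.symm]
    · intro q hq
      simp only [routeY, Finset.mem_insert, Finset.mem_singleton] at hq
      rcases hq with rfl | rfl | rfl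
      exacts [l7, l5, l3]
  have hlink : ∀ g ∈ routeNetwork R M K χ w P,
      stdGraph.LinkedIn (routeNetwork R M K χ w P : Set Heisenberg) o g := by
    intro g hg
    refine linkedIn_network ?_ ?_ ?_ hXM hYM hg
    · intro p hp
      rcases Finset.mem_union.1 hp with hp | hp
      · exact (hall p hp).1 p (Finset.mem_insert_self _ _)
      · obtain ⟨s, hs, hp⟩ := Finset.mem_biUnion.1 hp
        exact (hall s hs).1 p (Finset.mem_insert_of_mem hp)
    · intro q hq
      obtain ⟨s, hs, hq⟩ := Finset.mem_biUnion.1 hq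
      exact (hall s hs).2 q hq
    · intro p hp
      exact ((hall p hp).1 p (Finset.mem_insert_self _ _)).trans
        (linkedIn_ladder_xLine hp hχ).symm
  exact (hlink g hg).symm.trans (hlink h hh)

end RouteNetwork

/-! #### Loads -/

theorem card_route_le : (route s w).card ≤ 6 := by
  rw [route, Finset.card_disjSum]
  have h1 : (routeX s w).card ≤ 3 := Finset.card_le_three
  have h2 : (routeY s w).card ≤ 3 := Finset.card_le_three
  omega

/-- If `F` and data from a box of side `6 * N` determine the route, then `F` is equidistributed. -/
theorem card_filter_eq_le (F : ℤ × ℤ → ℤ × ℤ × ℤ → ℤ × ℤ)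
    (D : ℤ × ℤ → ℤ × ℤ × ℤ → ℤ × ℤ × ℤ × ℤ)
    (hD : ∀ s ∈ starts N, ∀ w ∈ options N, ((0 ≤ (D s w).1 ∧ (D s w).1 < 6 * N) ∧
      (0 ≤ (D s w).2.1 ∧ (D s w).2.1 < 6 * N) ∧ (0 ≤ (D s w).2.2.1 ∧ (D s w).2.2.1 < 6 * N) ∧
      (0 ≤ (D s w).2.2.2 ∧ (D s w).2.2.2 < 6 * N)))
    (hinj : ∀ s w s' w', F s w = F s' w' → D s w = D s' w' → s = s' ∧ w = w') (r : ℤ × ℤ) :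
    ((starts N ×ˢ options N).filter fun t => F t.1 t.2 = r).card ≤ (6 * N) ^ 4 := by
  set J := Finset.Ico (0 : ℤ) (6 * N) with hJ
  have hc : (J ×ˢ J ×ˢ J ×ˢ J).card = (6 * N) ^ 4 := by
    have : J.card = 6 * N := by rw [hJ, Int.card_Ico]; omega
    simp only [Finset.card_product, this]; ring
  rw [← hc]
  refine Finset.card_le_card_of_injOn (fun t => D t.1 t.2) ?_ ?_
  · rintro ⟨s, w⟩ ht
    obtain ⟨hs, hw⟩ := Finset.mem_product.1 (Finset.mem_filter.1 ht).1
    simpa [hJ] using hD s hs w hw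
  · rintro ⟨s, w⟩ ht ⟨s', w'⟩ ht' h
    obtain ⟨h1, h2⟩ := hinj s w s' w'
      ((Finset.mem_filter.1 ht).2.trans (Finset.mem_filter.1 ht').2.symm) h
    rw [h1, h2]

/-- Slope and defect, both `O(N)`, replace the height of the start, which ranges over `N ^ 2`
values. Once they, the abscissa of the start and the auxiliary slope are known, each of the three
points on the route determines the meeting point, hence the start. -/
theorem card_filter_mem_routeX_le (r : ℤ × ℤ) :
    ((starts N ×ˢ options N).filter fun t => r ∈ routeX t.1 t.2).card ≤ 3 * (6 * N) ^ 4 := by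
  have hD : ∀ s ∈ starts N, ∀ w ∈ options N, ((0 ≤ defect s w ∧ defect s w < 6 * N) ∧
      (0 ≤ slope s w ∧ slope s w < 6 * N) ∧ (0 ≤ s.1 ∧ s.1 < 6 * N) ∧
      (0 ≤ w.2.2 ∧ w.2.2 < 6 * N)) := by
    intro s hs w hw
    obtain ⟨⟨w1, w2⟩, -, w5, w6⟩ := mem_options.1 hw
    obtain ⟨⟨s1, s2⟩, -⟩ := mem_starts.1 hs
    obtain ⟨⟨t0, t1⟩, d0, d1⟩ := slope_defect_bounds hs hw
    refine ⟨⟨?_, ?_⟩, ⟨?_, ?_⟩, ⟨?_, ?_⟩, ?_, ?_⟩ <;> linarith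
  have key := fun F hF => card_filter_eq_le (N := N) F
    (fun s w => (defect s w, slope s w, s.1, w.2.2)) hD hF r
  have h1 := key (fun s w => (w.1, w.2.1 - defect s w)) ?_
  have h2 := key (fun s w => (w.1 + defect s w, w.2.1 + w.2.2 * defect s w)) ?_
  have h3 := key (fun s w => (w.1, w.2.1)) ?_
  · refine (Finset.card_le_card (t := _ ∪ (_ ∪ _)) ?_).trans ((Finset.card_union_le _ _).trans
      ((add_le_add h1 ((Finset.card_union_le _ _).trans (add_le_add h2 h3))).trans (by linarith)))
    intro t ht
    simp only [Finset.mem_union, Finset.mem_filter, routeX, Finset.mem_insert,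
      Finset.mem_singleton] at ht ⊢
    obtain ⟨ht, h | h | h⟩ := ht
    exacts [.inl ⟨ht, h.symm⟩, .inr (.inl ⟨ht, h.symm⟩), .inr (.inr ⟨ht, h.symm⟩)]
  all_goals
    rintro ⟨b, c⟩ ⟨x, y, z⟩ ⟨b', c'⟩ ⟨x', y', z'⟩ h h'
    have e := mul_slope_add_defect (s := (b, c)) (w := (x, y, z))
    have e' := mul_slope_add_defect (s := (b', c')) (w := (x', y', z'))
    simp only [Prod.mk.injEq] at h h' e e' ⊢
    obtain ⟨k1, k2⟩ := h
    obtain ⟨m1, m2, rfl, rfl⟩ := h'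
    rw [← m1, ← m2] at e'
    try rw [← m1] at k1
    try rw [← m1] at k2
    have hx : x = x' := by linarith
    subst hx
    have hy : y = y' := by linarith
    subst hy
    exact ⟨⟨rfl, by linarith⟩, rfl, rfl, rfl⟩

/-- The long line gives the slope and, with the abscissa of the start, its height; the abscissa of
the meeting point and the defect then give the meeting height. Either short line gives the auxiliary
slope and the meeting height, and the long slope and defect lead back to the start. -/
theorem card_filter_mem_routeY_le (r : ℤ × ℤ) :
    ((starts N ×ˢ options N).filter fun t => r ∈ routeY t.1 t.2).card ≤ 3 * (6 * N) ^ 4 := by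
  have h1 := card_filter_eq_le (N := N) (fun s w => (slope s w, s.2 - slope s w * s.1))
    (fun s w => (s.1, w.1, defect s w, w.2.2)) ?_ ?_ r
  have h2 := card_filter_eq_le (N := N)
    (fun s w => (w.2.2 + 1, w.2.1 - defect s w - (w.2.2 + 1) * w.1))
    (fun s w => (s.1, w.1, defect s w, slope s w)) ?_ ?_ r
  have h3 := card_filter_eq_le (N := N) (fun s w => (w.2.2, w.2.1 - w.2.2 * w.1))
    (fun s w => (s.1, w.1, defect s w, slope s w)) ?_ ?_ r
  · refine (Finset.card_le_card (t := _ ∪ (_ ∪ _)) ?_).trans ((Finset.card_union_le _ _).trans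
      ((add_le_add h1 ((Finset.card_union_le _ _).trans (add_le_add h2 h3))).trans (by linarith)))
    intro t ht
    simp only [Finset.mem_union, Finset.mem_filter, routeY, Finset.mem_insert,
      Finset.mem_singleton] at ht ⊢
    obtain ⟨ht, h | h | h⟩ := ht
    exacts [.inl ⟨ht, h.symm⟩, .inr (.inl ⟨ht, h.symm⟩), .inr (.inr ⟨ht, h.symm⟩)]
  rotate_left 1
  all_goals first
    | intro s hs w hw
      obtain ⟨⟨w1, w2⟩, -, w5, w6⟩ := mem_options.1 hw
      obtain ⟨⟨s1, s2⟩, -⟩ := mem_starts.1 hs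
      obtain ⟨⟨t0, t1⟩, d0, d1⟩ := slope_defect_bounds hs hw
      refine ⟨⟨?_, ?_⟩, ⟨?_, ?_⟩, ⟨?_, ?_⟩, ?_, ?_⟩ <;> linarith
    | rintro ⟨b, c⟩ ⟨x, y, z⟩ ⟨b', c'⟩ ⟨x', y', z'⟩ h h'
      have e := mul_slope_add_defect (s := (b, c)) (w := (x, y, z))
      have e' := mul_slope_add_defect (s := (b', c')) (w := (x', y', z'))
      simp only [Prod.mk.injEq] at h h' e e' ⊢
      obtain ⟨k1, k2⟩ := h
      obtain ⟨rfl, rfl, m1, m2⟩ := h'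
      first
        | rw [← m1, ← m2] at e'
          rw [← m1] at k2
          have hz : z = z' := by linarith
          subst hz
          have hy : y = y' := by linarith
          exact ⟨⟨rfl, by linarith⟩, rfl, hy, rfl⟩
        | rw [← m1, ← m2] at e'
          have hz : z = z' := by linarith
          subst hz
          have hy : y = y' := by linarith
          exact ⟨⟨rfl, by linarith⟩, rfl, hy, rfl⟩
        | rw [← k1] at k2
          rw [← m1, ← k1] at e'
          have hc : c = c' := by linarith
          exact ⟨⟨rfl, hc⟩, rfl, by linarith, m2⟩

/-- Every line lies on few routes. -/
theorem sum_card_filter_mem_route_le (r : (ℤ × ℤ) ⊕ (ℤ × ℤ)) :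
    ∑ s ∈ starts N, ((options N).filter fun w => r ∈ route s w).card ≤ 3888 * N ^ 4 := by
  have h : ∑ s ∈ starts N, ((options N).filter fun w => r ∈ route s w).card
      = ((starts N ×ˢ options N).filter fun t => r ∈ route t.1 t.2).card := by
    simp only [Finset.card_filter, Finset.sum_product]
  rw [h]
  rcases r with r | r
  · simp only [route, Finset.inl_mem_disjSum]
    exact (card_filter_mem_routeX_le r).trans (by ring_nf; rfl)
  · simp only [route, Finset.inr_mem_disjSum]
    exact (card_filter_mem_routeY_le r).trans (by ring_nf; rfl)

end Heisenberg

/-! ### Disjoint networks for the edges of a graph -/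

namespace Heisenberg

open SimpleGraph

section Routing

variable {V : Type*} [Fintype V]

theorem exists_injective_starts {N : ℕ} (hN : 0 < N) (h : Fintype.card V ≤ N ^ 3) :
    ∃ pos : V → ℤ × ℤ, Function.Injective pos ∧ ∀ v, pos v ∈ starts N := by
  -- Division with remainder by `N` maps numbers below `N ^ 3` into the `N × N ^ 2` grid.
  let ι := Fintype.equivFin V
  refine ⟨fun v => (((ι v : ℕ) % N : ℕ), ((ι v : ℕ) / N : ℕ)), fun u v huv => ?_, fun v => ?_⟩
  · simp only [Prod.mk.injEq, Nat.cast_inj] at huv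
    refine ι.injective (Fin.ext ?_)
    rw [← Nat.mod_add_div (ι u : ℕ) N, ← Nat.mod_add_div (ι v : ℕ) N, huv.1, huv.2]
  · refine mem_starts.2 ⟨⟨by positivity, ?_⟩, by positivity, ?_⟩ <;> simp only
    · exact_mod_cast Nat.mod_lt _ hN
    · exact_mod_cast Nat.div_lt_of_lt_mul (((ι v).2.trans_le h).trans_eq (by ring))

open Classical in
/-- The positions of the ends of an edge. -/
noncomputable def ends (pos : V → ℤ × ℤ) (e : Sym2 V) : Finset (ℤ × ℤ) :=
  (Finset.univ.filter (· ∈ e)).image pos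

variable {pos : V → ℤ × ℤ} {e e' : Sym2 V}

theorem mem_ends {p : ℤ × ℤ} : p ∈ ends pos e ↔ ∃ v ∈ e, pos v = p := by
  simp [ends]

theorem card_ends_le : (ends pos e).card ≤ 2 := by
  classical
  refine Finset.card_image_le.trans ?_
  induction e using Sym2.ind with
  | _ u v =>
    refine (Finset.card_le_card (t := {u, v}) fun x hx => ?_).trans Finset.card_le_two
    simpa using hx

theorem ends_subset {N : ℕ} (hpos : ∀ v, pos v ∈ starts N) : ends pos e ⊆ starts N := by
  intro p hp
  obtain ⟨v, -, rfl⟩ := mem_ends.1 hp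
  exact hpos v

theorem disjoint_ends (hinj : Function.Injective pos) (h : ∀ v ∈ e, v ∉ e') :
    Disjoint (ends pos e) (ends pos e') := by
  refine Finset.disjoint_left.2 fun p hp hp' => ?_
  obtain ⟨v, hv, rfl⟩ := mem_ends.1 hp
  obtain ⟨v', hv', h'⟩ := mem_ends.1 hp'
  exact h v hv (hinj h' ▸ hv')

variable {G : SimpleGraph V} [DecidableRel G.Adj] {d : ℕ}

theorem card_filter_mem_edge_le [Fintype G.edgeSet] (hd : G.maxDegree ≤ d) (v : V)
    [DecidablePred fun e : G.edgeSet => v ∈ e.1] :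
    (Finset.univ.filter fun e : G.edgeSet => v ∈ e.1).card ≤ d := by
  classical
  refine le_trans ?_ ((G.degree_le_maxDegree v).trans hd)
  rw [← card_incidenceFinset_eq_degree]
  refine Finset.card_le_card_of_injOn Subtype.val (fun e he => ?_) Subtype.val_injective.injOn
  rw [Finset.mem_coe, mem_incidenceFinset]
  exact ⟨e.2, by simpa using he⟩

theorem card_edgeSet_le [Fintype G.edgeSet] (hd : G.maxDegree ≤ d) :
    Fintype.card G.edgeSet ≤ Fintype.card V * d := by
  classical
  have h1 := G.sum_degrees_eq_twice_card_edges
  have h2 : ∑ v, G.degree v ≤ Fintype.card V * d :=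
    (Finset.sum_le_card_nsmul _ _ d fun v _ => (G.degree_le_maxDegree v).trans hd).trans_eq
      (by simp)
  rw [← edgeFinset_card]
  have h3 : G.edgeFinset.card ≤ ∑ v, G.degree v := by
    rw [h1]
    convert Nat.le_mul_of_pos_left G.edgeFinset.card two_pos
  exact h3.trans h2

/-- All edges can be routed and coloured such that routes of the same colour are disjoint. -/
theorem exists_routing [Fintype G.edgeSet] (hd : G.maxDegree ≤ d) {N : ℕ} (hN : 0 < N)
    (hinj : Function.Injective pos) (hpos : ∀ v, pos v ∈ starts N) {l : ℕ}
    (hl : (12 * (Fintype.card V * d) * N ^ 4 : ℝ) * Real.exp (3888 * d) < 2 ^ (l + 1)) :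
    ∃ (f : G.edgeSet → ℤ × ℤ × ℤ) (χ : G.edgeSet → ℕ), (∀ e, f e ∈ options N) ∧
      (∀ e, χ e ≤ 12 * l) ∧ ∀ e e', e ≠ e' → χ e = χ e' →
        Disjoint ((ends pos e.1).biUnion (route · (f e)))
          ((ends pos e'.1).biUnion (route · (f e'))) := by
  classical
  -- The resources of an edge are the lines on the two routes from its ends, at most `2 * 6`. The
  -- first-direction lines through the ends themselves are left out: edges without a common end have
  -- different ones.
  set U : G.edgeSet → ℤ × ℤ × ℤ → Finset ((ℤ × ℤ) ⊕ (ℤ × ℤ)) :=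
    fun e w => (ends pos e.1).biUnion (route · w) with hU
  have hUcard : ∀ e w, (U e w).card ≤ 12 := by
    intro e w
    have h1 := Finset.card_biUnion_le_card_mul (ends pos e.1) (route · w) 6
      fun s _ => card_route_le
    have h2 := card_ends_le (pos := pos) (e := e.1)
    simp only [hU]
    omega
  set Rs := (Finset.univ : Finset G.edgeSet).biUnion fun e => (options N).biUnion (U e) with hRs
  have hRcard : Rs.card ≤ 12 * (Fintype.card V * d) * N ^ 4 := by
    have h1 : Rs.card ≤ Fintype.card G.edgeSet * ((options N).card * 12) :=
      Finset.card_biUnion_le_card_mul _ _ _ fun e _ =>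
        Finset.card_biUnion_le_card_mul _ _ _ fun w _ => hUcard e w
    rw [card_options] at h1
    calc _ ≤ _ := h1
      _ ≤ (Fintype.card V * d) * (N ^ 4 * 12) := Nat.mul_le_mul_right _ (card_edgeSet_le hd)
      _ = _ := by ring
  -- Each position serves at most `d` edges, so the load is at most `d` times the load when every
  -- start is routed once.
  have hload : ∀ r, ∑ e, ((options N).filter fun w => r ∈ U e w).card
      ≤ d * (3888 * N ^ 4) := by
    intro r
    set cnt : ℤ × ℤ → ℕ := fun s => ((options N).filter fun w => r ∈ route s w).card with hcnt
    have h1 : ∀ e : G.edgeSet, ((options N).filter fun w => r ∈ U e w).card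
        ≤ ∑ v, if v ∈ e.1 then cnt (pos v) else 0 := by
      intro e
      rw [← Finset.sum_filter]
      refine (Finset.card_le_card (t := (Finset.univ.filter (· ∈ e.1)).biUnion fun v =>
        (options N).filter fun w => r ∈ route (pos v) w) fun w hw => ?_).trans
        Finset.card_biUnion_le
      obtain ⟨hw, hr⟩ := Finset.mem_filter.1 hw
      obtain ⟨s, hs, hr⟩ := Finset.mem_biUnion.1 hr
      obtain ⟨v, hv, rfl⟩ := mem_ends.1 hs
      exact Finset.mem_biUnion.2 ⟨v, by simpa using hv, Finset.mem_filter.2 ⟨hw, hr⟩⟩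
    calc _ ≤ ∑ e : G.edgeSet, ∑ v, (if v ∈ e.1 then cnt (pos v) else 0) :=
          Finset.sum_le_sum fun e _ => h1 e
      _ = ∑ v, (Finset.univ.filter fun e : G.edgeSet => v ∈ e.1).card * cnt (pos v) := by
          rw [Finset.sum_comm]
          refine Finset.sum_congr rfl fun v _ => ?_
          rw [← Finset.sum_filter, Finset.sum_const, smul_eq_mul]
      _ ≤ ∑ v, d * cnt (pos v) :=
          Finset.sum_le_sum fun v _ => Nat.mul_le_mul_right _ (card_filter_mem_edge_le hd v)
      _ = d * ∑ s ∈ Finset.univ.image pos, cnt s := by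
          rw [← Finset.mul_sum, Finset.sum_image fun u _ v _ h => hinj h]
      _ ≤ d * ∑ s ∈ starts N, cnt s := by
          gcongr
          intro s hs
          obtain ⟨v, -, rfl⟩ := Finset.mem_image.1 hs
          exact hpos v
      _ ≤ _ := Nat.mul_le_mul_left _ (sum_card_filter_mem_route_le r)
  obtain ⟨f, hf, hfl⟩ := exists_choice_two_pow_load_le (options N)
    (Finset.card_pos.1 (by rw [card_options]; positivity)) U Rs (3888 * d) (fun r => by
      rw [card_options]
      have := hload r
      calc _ ≤ ((d * (3888 * N ^ 4) : ℕ) : ℝ) := by exact_mod_cast this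
        _ = _ := by push_cast; ring)
  have hfl' : ∀ r, (Finset.univ.filter fun e => r ∈ U e (f e)).card ≤ l := by
    intro r
    by_cases hr : r ∈ Rs
    · have h1 := hfl r hr
      have h2 : (2 : ℝ) ^ (Finset.univ.filter fun e => r ∈ U e (f e)).card < 2 ^ (l + 1) := by
        refine (h1.trans ?_).trans_lt hl
        gcongr
        exact_mod_cast hRcard
      exact Nat.lt_succ_iff.1 ((pow_lt_pow_iff_right₀ one_lt_two).1 h2)
    · rw [Finset.filter_eq_empty_iff.2, Finset.card_empty]
      · exact Nat.zero_le _
      · intro e _ he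
        exact hr (Finset.mem_biUnion.2 ⟨e, Finset.mem_univ _,
          Finset.mem_biUnion.2 ⟨f e, hf e, he⟩⟩)
  -- An edge uses at most `12` lines, each shared by at most `l` edges, so it conflicts with at most
  -- `12 * l` edges.
  obtain ⟨χ, hχ, hχ'⟩ := exists_coloring_of_degree_le
    (fun e e' : G.edgeSet => ∃ r, r ∈ U e (f e) ∧ r ∈ U e' (f e'))
    (fun a b ⟨r, h1, h2⟩ => ⟨r, h2, h1⟩) (12 * l) (fun e => by
      have h1 : {e' : G.edgeSet | ∃ r, r ∈ U e (f e) ∧ r ∈ U e' (f e')} =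
          ((U e (f e)).biUnion fun r => Finset.univ.filter fun e' => r ∈ U e' (f e') :
            Finset G.edgeSet) := by
        ext e'
        simp
      rw [h1, Set.ncard_coe_finset]
      exact (Finset.card_biUnion_le_card_mul _ _ l fun r _ => hfl' r).trans
        (Nat.mul_le_mul_right _ (hUcard _ _)))
  refine ⟨f, χ, hf, hχ, fun e e' hne h => Finset.disjoint_left.2 fun r hr hr' => ?_⟩
  exact hχ' e e' hne ⟨r, hr, hr'⟩ h

/-- The networks of the edges of a graph, in terms of the scales `N` and `l`. -/
theorem exists_networks [Fintype G.edgeSet] (hd : G.maxDegree ≤ d) {N : ℕ} (hN : 0 < N)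
    (hNV : Fintype.card V ≤ N ^ 3) {l : ℕ}
    (hl : (12 * (Fintype.card V * d) * N ^ 4 : ℝ) * Real.exp (3888 * d) < 2 ^ (l + 1)) :
    ∃ (φ : V → Heisenberg) (A : Sym2 V → Finset Heisenberg) (A₁ : V → Finset Heisenberg),
      Function.Injective φ ∧
      (∀ e ∈ G.edgeSet, (A e).card ≤ 254 * N * (12 * l + 1) ∧
        (∀ p ∈ A e, ∀ q ∈ A e, stdGraph.LinkedIn (A e : Set Heisenberg) p q) ∧
        (∀ v ∈ e, φ v ∈ A e ∧ φ v * powY 1 ∈ A e) ∧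
        (∀ v ∉ e, Disjoint (A₁ v) (A e)) ∧
        ∀ e' ∈ G.edgeSet, (∀ v ∈ e, v ∉ e') → Disjoint (A e) (A e')) ∧
      (∀ v, φ v ∈ A₁ v ∧ φ v * powY 1 ∈ A₁ v) ∧
      ∀ u v, ∃ B : Finset Heisenberg, B.card ≤ 254 * N * (12 * l + 1) ∧
        (∀ p ∈ B, ∀ q ∈ B, stdGraph.LinkedIn (B : Set Heisenberg) p q) ∧
        (φ u ∈ B ∧ φ u * powY 1 ∈ B) ∧ φ v ∈ B ∧ φ v * powY 1 ∈ B := by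
  classical
  obtain ⟨pos, hinj, hpos⟩ := exists_injective_starts hN hNV
  obtain ⟨f, χ, hf, hχ, hdisj⟩ := exists_routing hd hN hinj hpos hl
  set K : ℕ := 12 * l with hK
  -- An even factor with `2 * K + 1 < R ^ 2`, so that all `K + 1` colours fit below the next level;
  -- `M` is `6 * N * R`, long enough for every crossing.
  set R : ℤ := 2 * (K + 1) with hR
  set M : ℕ := 12 * N * (K + 1) with hM
  have hR1 : 1 < R := by rw [hR]; linarith [Int.natCast_nonneg K]
  have hRev : Even R := ⟨K + 1, by rw [hR]; ring⟩
  have hKR : 2 * (K : ℤ) + 1 < R ^ 2 := by rw [hR]; nlinarith [Int.natCast_nonneg K]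
  have hMR : 6 * N * R ≤ M := by rw [hM, hR]; push_cast; linarith
  have hcard : ∀ χ w e, (routeNetwork R M K χ w (ends pos e)).card ≤ 254 * N * (K + 1) := by
    intro χ w e
    refine (card_routeNetwork_le card_ends_le).trans ?_
    have h1 : K + 1 ≤ N * (K + 1) := Nat.le_mul_of_pos_left _ hN
    rw [hM]
    linarith
  set φ : V → Heisenberg := fun v => ⟨0, R * (pos v).1, R ^ 2 * (pos v).2⟩ with hφ
  have hφl : ∀ v, φ v ∈ ladder R K (pos v) ∧ φ v * powY 1 ∈ ladder R K (pos v) := by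
    intro v
    simp [mem_ladder, hφ, powY]
  have hφr : ∀ χ w e, ∀ v ∈ e, φ v ∈ routeNetwork R M K χ w (ends pos e) ∧
      φ v * powY 1 ∈ routeNetwork R M K χ w (ends pos e) := by
    intro χ w e v hv
    have h := ladder_subset_network (R := R) (M := M) (K := K) (χ := χ)
      (X := ends pos e ∪ (ends pos e).biUnion (routeX · w))
      (Y := (ends pos e).biUnion (routeY · w)) (L := ends pos e) (mem_ends.2 ⟨v, hv, rfl⟩)
    exact ⟨h (hφl v).1, h (hφl v).2⟩
  have hfar : ∀ e w, w ∈ options N → ∀ p ∈ starts N,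
      p ∉ (ends pos e).biUnion (routeX · w) := by
    intro e w hw p hp hp'
    obtain ⟨s, hs, hps⟩ := Finset.mem_biUnion.1 hp'
    have h1 := (fst_bounds_of_mem_routeX (ends_subset hpos hs) hw hps).1
    have h2 := (mem_starts.1 hp).1
    linarith [h2.1, h2.2]
  have hYpos : ∀ e w, w ∈ options N → ∀ q ∈ (ends pos e).biUnion (routeY · w), 1 ≤ q.1 := by
    intro e w hw q hq
    obtain ⟨s, hs, hqs⟩ := Finset.mem_biUnion.1 hq
    exact (fst_bounds_of_mem_routeY (ends_subset hpos hs) hw hqs).1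
  have hLX : ∀ (P : Finset (ℤ × ℤ)) e w, P ⊆ starts N → w ∈ options N →
      Disjoint P (ends pos e) →
      Disjoint P (ends pos e ∪ (ends pos e).biUnion (routeX · w)) := by
    intro P e w hP hw h
    refine Finset.disjoint_union_right.2 ⟨h, Finset.disjoint_left.2 fun p hp => ?_⟩
    exact hfar e w hw p (hP hp)
  -- A vertex is represented by its bare ladder, a network without lines, so that its disjointness
  -- from edges is another case of `disjoint_network`.
  refine ⟨φ, fun e => if h : e ∈ G.edgeSet then routeNetwork R M K (χ ⟨e, h⟩) (f ⟨e, h⟩)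
    (ends pos e) else ∅, fun v => network R M K 0 ∅ ∅ {pos v}, ?_, ?_, ?_, ?_⟩
  · intro u v huv
    refine hinj (Prod.ext ?_ ?_)
    · exact mul_left_cancel₀ (by linarith : R ≠ 0) (congrArg b huv)
    · exact mul_left_cancel₀ (pow_ne_zero 2 (by linarith : R ≠ 0)) (congrArg c huv)
  · intro e he
    simp only [he, dif_pos]
    refine ⟨hcard _ _ _, fun p hp q hq => ?_, hφr _ _ e, fun v hv => ?_, fun e' he' hee => ?_⟩
    · exact linkedIn_routeNetwork hR1 hMR (hχ _) (ends_subset hpos) (hf _) hp hq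
    · have hd : Disjoint {pos v} (ends pos e) := by
        refine Finset.disjoint_singleton_left.2 fun h => ?_
        obtain ⟨u, hu, huv⟩ := mem_ends.1 h
        exact hv (hinj huv ▸ hu)
      refine disjoint_network hR1 hRev hKR (Nat.zero_le _) (hχ _) (by simp)
        (hYpos e _ (hf _)) (by simp) (by simp) hd
        (hLX _ e _ (by simpa using hpos v) (hf _) hd) (by simp)
    · simp only [he', dif_pos]
      have hd := disjoint_ends hinj hee
      have hne : (⟨e, he⟩ : G.edgeSet) ≠ ⟨e', he'⟩ := by
        intro h
        have h' : e = e' := congrArg Subtype.val h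
        subst h'
        induction e using Sym2.ind with
        | _ u v => exact hee u (Sym2.mem_mk_left _ _) (Sym2.mem_mk_left _ _)
      have hroute : χ ⟨e, he⟩ = χ ⟨e', he'⟩ → ∀ s ∈ ends pos e, ∀ s' ∈ ends pos e', ∀ x,
          x ∈ route s (f ⟨e, he⟩) → x ∈ route s' (f ⟨e', he'⟩) → False := by
        intro h s hs s' hs' x hx hx'
        exact Finset.disjoint_left.1 (hdisj _ _ hne h) (Finset.mem_biUnion.2 ⟨s, hs, hx⟩)
          (Finset.mem_biUnion.2 ⟨s', hs', hx'⟩)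
      refine disjoint_network hR1 hRev hKR (hχ _) (hχ _) (hYpos e _ (hf _)) (hYpos e' _ (hf _))
        (fun h => ?_) (fun h => ?_) hd (hLX _ e' _ (ends_subset hpos) (hf _) hd)
        (hLX _ e _ (ends_subset hpos) (hf _) hd.symm).symm
      · refine Finset.disjoint_union_left.2 ⟨hLX _ e' _ (ends_subset hpos) (hf _) hd,
          Finset.disjoint_union_right.2 ⟨?_, ?_⟩⟩
        · exact Finset.disjoint_right.2 fun p hp => hfar e _ (hf _) p (ends_subset hpos hp)
        · refine Finset.disjoint_left.2 fun p hp hp' => ?_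
          obtain ⟨s, hs, hps⟩ := Finset.mem_biUnion.1 hp
          obtain ⟨s', hs', hps'⟩ := Finset.mem_biUnion.1 hp'
          exact hroute h s hs s' hs' (.inl p) (Finset.inl_mem_disjSum.2 hps)
            (Finset.inl_mem_disjSum.2 hps')
      · refine Finset.disjoint_left.2 fun p hp hp' => ?_
        obtain ⟨s, hs, hps⟩ := Finset.mem_biUnion.1 hp
        obtain ⟨s', hs', hps'⟩ := Finset.mem_biUnion.1 hp'
        exact hroute h s hs s' hs' (.inr p) (Finset.inr_mem_disjSum.2 hps)
          (Finset.inr_mem_disjSum.2 hps')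
  · intro v
    have h := ladder_subset_network (R := R) (M := M) (K := K) (χ := 0) (X := ∅) (Y := ∅)
      (L := {pos v}) (Finset.mem_singleton_self _)
    exact ⟨h (hφl v).1, h (hφl v).2⟩
  · intro u v
    -- For the distance of two vertices only size and connectedness matter, so any option and colour
    -- `0` serve, whether or not the pair is an edge.
    obtain ⟨w, hw⟩ : (options N).Nonempty :=
      Finset.card_pos.1 (by rw [card_options]; positivity)
    exact ⟨routeNetwork R M K 0 w (ends pos s(u, v)), hcard _ _ _, fun p hp q hq =>
      linkedIn_routeNetwork hR1 hMR (Nat.zero_le _) (ends_subset hpos) hw hp hq,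
      hφr _ _ _ u (Sym2.mem_mk_left _ _), hφr _ _ _ v (Sym2.mem_mk_right _ _)⟩

end Routing

end Heisenberg

/-! ### Constants and conclusion -/

/-- Scales for which the routing of graphs with `n` vertices and degree at most `d` succeeds. -/
theorem exists_scales (d : ℕ) : ∃ C : ℝ, 0 < C ∧ ∀ n : ℕ, 1 ≤ n → ∃ N l : ℕ, 0 < N ∧ n ≤ N ^ 3 ∧
    (12 * (n * d) * N ^ 4 : ℝ) * Real.exp (3888 * d) < 2 ^ (l + 1) ∧
    (254 * N * (12 * l + 1) : ℝ) ≤ C * (n : ℝ) ^ (1 / 3 : ℝ) * Real.log (1 + n) := by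
  -- As `N ≤ 2 * n`, the quantity to be bounded is at most `12 * 2 ^ 4 * d * n ^ 5` times the
  -- exponential; `12 * 2 ^ 4 = 192`.
  set Q : ℝ := 192 * (d + 1) * Real.exp (3888 * d) with hQ
  have hQ1 : 1 ≤ Q := by
    have h1 : (1 : ℝ) ≤ Real.exp (3888 * d) := Real.one_le_exp (by positivity)
    have h2 : (0 : ℝ) ≤ d := by positivity
    nlinarith
  have hlQ : 0 ≤ Real.log Q := Real.log_nonneg hQ1
  refine ⟨508 * (48 * Real.log Q + 122), by positivity, fun n hn => ?_⟩
  have hn1 : (1 : ℝ) ≤ n := by exact_mod_cast hn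
  set x : ℝ := (n : ℝ) ^ (1 / 3 : ℝ) with hx
  have hx1 : 1 ≤ x := Real.one_le_rpow hn1 (by norm_num)
  have hx3 : x ^ 3 = n := by
    rw [hx, ← Real.rpow_natCast, ← Real.rpow_mul (by positivity)]
    norm_num
  have hxn : x ≤ n := by rw [← hx3]; exact le_self_pow₀ hx1 (by norm_num)
  set N := ⌈x⌉₊ with hN
  have hxN : x ≤ N := Nat.le_ceil x
  have hNx : (N : ℝ) ≤ 2 * x := by
    have := Nat.ceil_lt_add_one (zero_le_one.trans hx1)
    linarith
  set B : ℝ := Q * (1 + n) ^ 5 with hB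
  have hB1 : 1 ≤ B := one_le_mul_of_one_le_of_one_le hQ1 (one_le_pow₀ (by linarith))
  set L : ℝ := Real.log (1 + n) with hL
  have hl2 : (1 / 2 : ℝ) ≤ Real.log 2 := by linarith [Real.log_two_gt_d9]
  have hL2 : 1 / 2 ≤ L := hl2.trans (Real.log_le_log (by norm_num) (by linarith))
  have hlB : Real.log B = Real.log Q + 5 * L := by
    rw [hB, Real.log_mul (by linarith) (by positivity), Real.log_pow]
    push_cast
    ring
  have hlB0 : 0 ≤ Real.log B := Real.log_nonneg hB1
  set l := ⌊Real.log B / Real.log 2⌋₊ with hl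
  refine ⟨N, l, Nat.ceil_pos.2 (by linarith), ?_, ?_, ?_⟩
  · have : (n : ℝ) ≤ (N : ℝ) ^ 3 := by rw [← hx3]; gcongr
    exact_mod_cast this
  · have h1 : (12 * (n * d) * N ^ 4 : ℝ) * Real.exp (3888 * d) ≤ B := by
      have h2 : (N : ℝ) ^ 4 ≤ (2 * n) ^ 4 := by gcongr; linarith
      calc _ ≤ (12 * (n * d) * (2 * n) ^ 4 : ℝ) * Real.exp (3888 * d) := by gcongr
        _ = 192 * d * Real.exp (3888 * d) * n ^ 5 := by ring
        _ ≤ B := by rw [hB, hQ]; gcongr <;> linarith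
    refine h1.trans_lt ?_
    rw [← Real.log_lt_log_iff (by linarith) (by positivity), Real.log_pow]
    have := Nat.lt_floor_add_one (Real.log B / Real.log 2)
    rw [div_lt_iff₀ (by linarith)] at this
    exact_mod_cast this
  · have h1 : (l : ℝ) ≤ 2 * Real.log B := by
      refine (Nat.floor_le (by positivity)).trans ?_
      rw [div_le_iff₀ (by linarith)]
      nlinarith
    -- From `l ≤ 2 * (log Q + 5 * L)`; since `1 ≤ 2 * L`, the terms without `L` are absorbed at the
    -- cost of a factor `2`.
    have h2 : 12 * (l : ℝ) + 1 ≤ (48 * Real.log Q + 122) * L := by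
      rw [hlB] at h1
      nlinarith
    calc (254 * N * (12 * l + 1) : ℝ) ≤ 254 * (2 * x) * ((48 * Real.log Q + 122) * L) := by gcongr
      _ = _ := by ring

/-! ### Transfer to an arbitrary generating set -/

namespace Heisenberg

/-- Only edges are thickened, so a dilated vertex is covered once an edge at it lies in the set;
hence vertices are carried along with their neighbour `p * powY 1`. -/
theorem dilate_mem_thicken {k : ℕ} {A B : Finset Heisenberg} (hB : 1 ∈ B) {p : Heisenberg}
    (hp : p ∈ A) (hp' : p * powY 1 ∈ A) : dilate k p ∈ thicken k B A :=
  mem_thicken.2 ⟨p, hp, 0, Nat.zero_le _, 1, hB, .inr ⟨hp', by ext <;> simp [powY]⟩⟩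

/-- A finite set containing all neighbours of `g` in the Cayley graph. -/
noncomputable def neighbours (T : Finset Heisenberg) (g : Heisenberg) : Finset Heisenberg :=
  (T ∪ T.image (·⁻¹)).image (g * ·)

theorem card_neighbours_le (T : Finset Heisenberg) (g : Heisenberg) :
    (neighbours T g).card ≤ (T ∪ T.image (·⁻¹)).card :=
  Finset.card_image_le

theorem mem_neighbours {T : Finset Heisenberg} {g h : Heisenberg}
    (hgh : (SimpleGraph.mulCayley (T : Set Heisenberg)).Adj g h) : h ∈ neighbours T g := by
  refine Finset.mem_image.2 ⟨g⁻¹ * h, Finset.mem_union.2 ?_, by simp⟩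
  refine ((SimpleGraph.mulCayley_adj _ _ _).1 hgh).2.imp id fun h' =>
    Finset.mem_image.2 ⟨h⁻¹ * g, h', by simp⟩

end Heisenberg

open Heisenberg in
theorem exists_isThickEmbedding_mulCayley (d : ℕ) (S : Set Heisenberg) (hfin : S.Finite)
    (hgen : Subgroup.closure S = ⊤) :
    ∃ κ D : ℕ, 0 < κ ∧ ∀ {V : Type*} [Fintype V] (G : SimpleGraph V) [DecidableRel G.Adj],
      G.maxDegree ≤ d → ∀ {N l : ℕ}, 0 < N → Fintype.card V ≤ N ^ 3 →
      (12 * (Fintype.card V * d) * N ^ 4 : ℝ) * Real.exp (3888 * d) < 2 ^ (l + 1) →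
        ∃ f : Realization G → MetricGraph (SimpleGraph.mulCayley S),
          IsThickEmbedding 1 f ∧
          Metric.ediam (range f) ≤ ((3 * (κ * (254 * N * (12 * l + 1))) + 2 : ℕ) : ℝ≥0∞) ∧
          thickVolume MetricGraph.lengthMeasure f ≤
            (((Fintype.card V + Fintype.card V * d * (κ * (254 * N * (12 * l + 1)))) *
              (D + 1) * D : ℕ) : ℝ≥0∞) := by
  classical
  obtain ⟨B, hTB, hB⟩ := SimpleGraph.exists_finset_linkedIn hgen {1, powX 1, powY 1}
  have h1 : 1 ∈ B := hTB (by simp)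
  have hx : powX 1 ∈ B := hTB (by simp)
  have hy : powY 1 ∈ B := hTB (by simp)
  obtain ⟨k, hk, hdis⟩ := exists_disjoint_thicken B
  obtain ⟨T, rfl⟩ := hfin.exists_finset_coe
  refine ⟨2 * ((k + 1) * B.card), (T ∪ T.image (·⁻¹)).card, ?_, ?_⟩
  · have := Finset.card_pos.2 ⟨_, h1⟩
    positivity
  intro V _ G _ hd N l hN hNV hl
  obtain ⟨φ, A, A₁, hφ, hA, hA₁, hpair⟩ := exists_networks hd hN hNV hl
  have hcard : ∀ A : Finset Heisenberg, A.card ≤ 254 * N * (12 * l + 1) →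
      (thicken k B A).card ≤ 2 * ((k + 1) * B.card) * (254 * N * (12 * l + 1)) := fun A h =>
    card_thicken_le.trans (Nat.mul_le_mul_left _ h)
  obtain ⟨f, hf, hdiam, hvol⟩ := MetricGraph.exists_isThickEmbedding (G := G)
    (H := SimpleGraph.mulCayley (T : Set Heisenberg)) (nb := neighbours T)
    (fun v w h => mem_neighbours h) (card_neighbours_le T) (φ := fun v => dilate k (φ v))
    ((dilate_injective (by exact_mod_cast hk.ne')).comp hφ) (A := fun e => thicken k B (A e))
    (fun e he a ha b hb => linkedIn_thicken hB h1 hx hy (hA e he).2.1 ha hb)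
    (fun e he v hv => dilate_mem_thicken h1 ((hA e he).2.2.1 v hv).1 ((hA e he).2.2.1 v hv).2)
    (fun e he e' he' h => hdis _ _ ((hA e he).2.2.2.2 e' he' h))
    (fun e he v hv => Finset.disjoint_left.1 (hdis _ _ ((hA e he).2.2.2.1 v hv))
      (dilate_mem_thicken h1 (hA₁ v).1 (hA₁ v).2))
    (fun e he => hcard _ (hA e he).1) (fun u v => by
      obtain ⟨P, hPc, hP, ⟨hu, hu'⟩, hv, hv'⟩ := hpair u v
      refine (MetricGraph.edist_vertex_le_card (linkedIn_thicken (k := k) hB h1 hx hy hP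
        (dilate_mem_thicken h1 hu hu') (dilate_mem_thicken h1 hv hv'))).trans ?_
      exact_mod_cast hcard P hPc)
  refine ⟨f, hf, hdiam, hvol.trans ?_⟩
  gcongr
  exact card_edgeSet_le hd

theorem theoremB (d : ℕ) (S : Set Heisenberg) (hfin : S.Finite)
    (hgen : Subgroup.closure S = ⊤) :
    ∃ C : ℝ, ∀ (V : Type*) [Fintype V] (G : SimpleGraph V) [DecidableRel G.Adj],
      G.maxDegree ≤ d →
        ∃ f : Realization G → MetricGraph (SimpleGraph.mulCayley S),
          IsThickEmbedding 1 f ∧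
          Metric.ediam (range f) ≤
            ENNReal.ofReal (C * (Fintype.card V : ℝ) ^ (1 / 3 : ℝ)
              * Real.log (1 + Fintype.card V)) ∧
          thickVolume MetricGraph.lengthMeasure f ≤
            ENNReal.ofReal (C * (Fintype.card V : ℝ) ^ (4 / 3 : ℝ)
              * Real.log (1 + Fintype.card V) ^ 2) := by
  obtain ⟨κ, D, hκ, hemb⟩ := exists_isThickEmbedding_mulCayley d S hfin hgen
  obtain ⟨C, hC, hscale⟩ := exists_scales d
  refine ⟨κ * C * (5 + 2 * ((1 + d) * (D + 1) * D)), fun V _ G _ hd => ?_⟩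
  -- Without vertices both bounds are `0` and the image is empty; otherwise `n ≥ 1` makes the
  -- logarithm at least `1 / 2`.
  rcases isEmpty_or_nonempty V with hV | hV
  · have hE : IsEmpty (Realization G) := ⟨fun x => by
      induction x using Quot.ind with
      | mk x =>
        rcases x with v | ⟨e, -⟩
        exacts [hV.elim v, hV.elim e.fst]⟩
    refine ⟨fun x => hE.elim x, ⟨continuous_of_const fun x => hE.elim x, fun u => hV.elim u,
      fun u => hV.elim u, fun e => hV.elim e.fst⟩, ?_, ?_⟩
    · rw [range_eq_empty, Metric.ediam_empty]
      exact zero_le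
    · rw [thickVolume, range_eq_empty, Metric.cthickening_empty, measure_empty]
      exact zero_le
  · set n := Fintype.card V with hn
    obtain ⟨N, l, hN, hNn, hl, hle⟩ := hscale n Fintype.card_pos
    obtain ⟨f, hf, hdiam, hvol⟩ := hemb G hd hN hNn hl
    set m : ℕ := κ * (254 * N * (12 * l + 1)) with hm
    have hn1 : (1 : ℝ) ≤ n := by exact_mod_cast (Fintype.card_pos : 0 < Fintype.card V)
    set x : ℝ := (n : ℝ) ^ (1 / 3 : ℝ) with hx
    set L : ℝ := Real.log (1 + n) with hL
    have hx0 : 0 ≤ x := by positivity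
    have hL2 : 1 / 2 ≤ L := by
      have h2 : (1 / 2 : ℝ) ≤ Real.log 2 := by linarith [Real.log_two_gt_d9]
      exact h2.trans (Real.log_le_log (by norm_num) (by linarith))
    have hm1 : 1 ≤ m := Nat.one_le_iff_ne_zero.2 (by positivity)
    have hmle : (m : ℝ) ≤ κ * C * (x * L) := by
      rw [hm]
      push_cast
      calc _ ≤ (κ : ℝ) * (C * x * L) := mul_le_mul_of_nonneg_left hle (by positivity)
        _ = _ := by ring
    have hnx : (n : ℝ) ^ (4 / 3 : ℝ) = n * x := by
      rw [hx, ← Real.rpow_one_add' (by positivity) (by norm_num)]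
      norm_num
    refine ⟨f, hf, hdiam.trans ?_, hvol.trans ?_⟩
    · rw [← ENNReal.ofReal_natCast]
      refine ENNReal.ofReal_le_ofReal ?_
      have h1 : ((3 * m + 2 : ℕ) : ℝ) ≤ 5 * m := by exact_mod_cast (by omega : 3 * m + 2 ≤ 5 * m)
      calc _ ≤ _ := h1
        _ ≤ (5 + 2 * ((1 + d) * (D + 1) * D)) * (κ * C * (x * L)) := by
            refine mul_le_mul ?_ hmle (by positivity) (by positivity)
            exact le_add_of_nonneg_right (by positivity)
        _ = _ := by ring
    · rw [← ENNReal.ofReal_natCast, hnx]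
      refine ENNReal.ofReal_le_ofReal ?_
      have h1 : (((n + n * d * m) * (D + 1) * D : ℕ) : ℝ) ≤ (1 + d) * (D + 1) * D * (n * m) := by
        have : (n + n * d * m) * (D + 1) * D ≤ (1 + d) * (D + 1) * D * (n * m) := by
          have h2 : n + n * d * m ≤ (1 + d) * (n * m) := by
            have := Nat.mul_le_mul_left n hm1
            linarith
          calc _ ≤ ((1 + d) * (n * m)) * (D + 1) * D :=
                Nat.mul_le_mul_right _ (Nat.mul_le_mul_right _ h2)
            _ = _ := by ring
        exact_mod_cast this
      -- The construction yields one logarithm in the volume; `L ≤ 2 * L ^ 2` relaxes it to the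
      -- stated square.
      have h3 : (m : ℝ) ≤ κ * C * (x * (2 * L ^ 2)) := by
        refine hmle.trans ?_
        gcongr
        nlinarith
      calc _ ≤ _ := h1
        _ ≤ (1 + d) * (D + 1) * D * (n * (κ * C * (x * (2 * L ^ 2)))) := by gcongr
        _ = 2 * ((1 + d) * (D + 1) * D) * (κ * C * (n * x) * L ^ 2) := by ring
        _ ≤ (5 + 2 * ((1 + d) * (D + 1) * D)) * (κ * C * (n * x) * L ^ 2) := by
            gcongr
            linarith
        _ = _ := by ring
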